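/- **Setting.** Let $K$ be a global field, presented as a finite separable extension of $K_0=\mathbb{Q}$ or $K_0=\mathbb{F}_p(t)$ ($p$ prime). The standard absolute values on $\mathbb{Q}$ are the usual one and the $p$-adic ones with $|p|_p=1/p$; those on $\mathbb{F}_p(t)$ are $|f|_\infty=p^{\deg f}$ and $|f|_\pi=p^{-\deg(\pi)\,\mathrm{ord}_\pi(f)}$ for $\pi$ monic irreducible. Let $M_K$ be the set of absolute values on $K$ extending a standard absolute value of $K_0$. For $v\in M_K$ with restriction $u$ to $K_0$, let $K_v$ and $(K_0)_u$ be the completions and let $n_v=[K_v:(K_0)_u]/[K:K_0]$ be the normalized local degree. Put $\|(x,y)\|_v=\max\{|x|_v,|y|_v\}$ on $K_v^2$, and let $h([x,y])=\sum_{v\in M_K}n_v\log\|(x,y)\|_v$ be the absolute logarithmic Weil height on $\mathbb{P}^1(K)$. Let $S$ be a finite set of endomorphisms of $\mathbb{P}^1$ defined over $K$, each of degree at least $2$. For each $\phi\in S$ fix a lift $\tilde\phi=(F,G):\mathbb{A}^2\to\mathbb{A}^2$, where $F,G\in K[x,y]$ are homogeneous of degree $\deg\phi$, have no common zero in $\mathbb{P}^1(\overline{K})$,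 and satisfy $\phi=[F:G]$. Let $\gamma=(\theta_n)_{n\ge1}$ be a sequence of elements of $S$ and $\tilde\gamma=(\tilde\theta_n)_{n\ge1}$ the corresponding sequence of lifts. Write $\gamma_n=\theta_n\circ\cdots\circ\theta_1$, $\tilde\gamma_n=\tilde\theta_n\circ\cdots\circ\tilde\theta_1$ and $\deg\gamma_n=\deg\tilde\gamma_n=\prod_{i\le n}\deg\theta_i$. Set $$\hat h_\gamma(P)=\lim_{n\to\infty}\frac{h(\gamma_n(P))}{\deg\gamma_n}\quad(P\in\mathbb{P}^1(K)),\qquad \mathcal{G}_{v,\tilde\gamma}(x,y)=\lim_{n\to\infty}\frac{\log\|\tilde\gamma_n(x,y)\|_v}{\deg\tilde\gamma_n}\quad((x,y)\in K_v^2\setminus\{0\}).$$ Let $E\in K[x,y]$ be a homogeneous polynomial of degree $e$ and define, for $[x,y]\in\mathbb{P}^1(K_v)$ with $E(x,y)\ne0$, $$\hat\lambda_{v,\tilde\gamma,E}([x,y])=e\,\mathcal{G}_{v,\tilde\gamma}(x,y)-\log|E(x,y)|_v .$$ **Theorem 4.2.** The following hold. 1. For every $v\in M_K$ the limit defining $\mathcal{G}_{v,\tilde\gamma}$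 exists on $K_v^2\setminus\{0\}$, and $\hat\lambda_{v,\tilde\gamma,E}:\mathbb{P}^1(K_v)\setminus\{E=0\}\to\mathbb{R}$ is well defined, that is, independent of the choice of homogeneous coordinates. 2. For every $v\in M_K$ the function $P\mapsto\hat\lambda_{v,\tilde\gamma,E}(P)+\log\frac{|E(P)|_v}{\|P\|_v^{e}}$ on $\mathbb{P}^1(K_v)\setminus\{E=0\}$ extends to a bounded continuous function on all of $\mathbb{P}^1(K_v)$. 3. If $e\ge1$, then for every $P\in\mathbb{P}^1(K)\setminus\{E=0\}$ the limit defining $\hat h_\gamma(P)$ exists and $$\hat h_\gamma(P)=\frac{1}{\deg(E)}\sum_{v\in M_K}n_v\,\hat\lambda_{v,\tilde\gamma,E}(P),$$ where only finitely many terms of the sum are nonzero. -/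

import Mathlib

open scoped LinearAlgebra.Projectivization
open Filter Topology

namespace LocalHeights

noncomputable section

/-! ### Global fields, places and completions -/

/-- The standard absolute values on `ℚ`: the usual one and the `p`-adic ones with `|p|_p = 1/p`. -/
def ratAbs : Set (AbsoluteValue ℚ ℝ) :=
  {u | u = Rat.AbsoluteValue.real ∨
    ∃ (p : ℕ) (_ : Fact p.Prime), u = Rat.AbsoluteValue.padic p}

/-- The standard absolute values on `𝔽_p(t)`: the one at infinity, `|f| = p ^ deg f`, and for every
monic irreducible `π` the `π`-adic one, `|f| = p ^ (-(deg π) * ord_π f)`. An absolute value on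
`𝔽_p(t)` is determined by its values on nonzero polynomials. -/
def ratFuncAbs (p : ℕ) [Fact p.Prime] : Set (AbsoluteValue (RatFunc (ZMod p)) ℝ) :=
  {u | (∀ f : Polynomial (ZMod p), f ≠ 0 →
      u (algebraMap (Polynomial (ZMod p)) (RatFunc (ZMod p)) f) = (p : ℝ) ^ f.natDegree) ∨
    ∃ π : Polynomial (ZMod p), π.Monic ∧ Irreducible π ∧
      ∀ f : Polynomial (ZMod p), f ≠ 0 →
        u (algebraMap (Polynomial (ZMod p)) (RatFunc (ZMod p)) f) =
          ((p : ℝ) ^ (π.natDegree * multiplicity π f))⁻¹}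

/-- `IsGlobalBase K₀ M₀`: the field `K₀` is `ℚ` or `𝔽_p(t)` for a prime `p`, and `M₀` is its set of
standard absolute values. The global fields are the finite separable extensions of such `K₀`. -/
inductive IsGlobalBase : (K₀ : Type) → [Field K₀] → Set (AbsoluteValue K₀ ℝ) → Prop
  | rat : IsGlobalBase ℚ ratAbs
  | ratFunc (p : ℕ) [Fact p.Prime] : IsGlobalBase (RatFunc (ZMod p)) (ratFuncAbs p)

section Places

variable {K₀ : Type*} [Field K₀] {K : Type*} [Field K] [Algebra K₀ K]

/-- The restriction to `K₀` of an absolute value on `K`. -/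
def restrict (K₀ : Type*) [Field K₀] {K : Type*} [Field K] [Algebra K₀ K]
    (v : AbsoluteValue K ℝ) : AbsoluteValue K₀ ℝ :=
  v.comp (algebraMap K₀ K).injective

/-- The set `M_K` of standard absolute values on `K`: those that extend a standard absolute value
of `K₀`. -/
abbrev Place (M₀ : Set (AbsoluteValue K₀ ℝ)) (K : Type*) [Field K] [Algebra K₀ K] : Type _ :=
  {v : AbsoluteValue K ℝ // restrict K₀ v ∈ M₀}

/-- The embedding of `K` in its completion `K_v`. -/
def toCompletion (v : AbsoluteValue K ℝ) : K →+* v.Completion :=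
  (UniformSpace.Completion.coeRingHom (α := WithAbs v)).comp (WithAbs.equiv v).symm.toRingHom

theorem norm_toCompletion (v : AbsoluteValue K ℝ) (x : K) : ‖toCompletion v x‖ = v x :=
  UniformSpace.Completion.norm_coe _

theorem isometry_map (v : AbsoluteValue K ℝ) :
    Isometry (WithAbs.map (restrict K₀ v) v (algebraMap K₀ K)) :=
  AddMonoidHomClass.isometry_of_norm _ fun _ => rfl

/-- For an absolute value `v` on `K` with restriction `u` to `K₀`, the inclusion of the completion
`(K₀)_u` in the completion `K_v`, the continuous extension of `K₀ → K`. -/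
def completionMap (K₀ : Type*) [Field K₀] {K : Type*} [Field K] [Algebra K₀ K]
    (v : AbsoluteValue K ℝ) : (restrict K₀ v).Completion →+* v.Completion :=
  UniformSpace.Completion.mapRingHom (WithAbs.map (restrict K₀ v) v (algebraMap K₀ K))
    (isometry_map v).continuous

/-- The local degree `[K_v : (K₀)_u]`, where `u` is the restriction of `v` to `K₀`. -/
def localDegree (K₀ : Type*) [Field K₀] {K : Type*} [Field K] [Algebra K₀ K]
    (v : AbsoluteValue K ℝ) : ℕ :=
  letI : Algebra (restrict K₀ v).Completion v.Completion := (completionMap K₀ v).toAlgebra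
  Module.finrank (restrict K₀ v).Completion v.Completion

/-- The normalized local degree `n_v = [K_v : (K₀)_u] / [K : K₀]`. With this normalization
`∑ n_v log ‖·‖_v` is the absolute logarithmic height. -/
def weight (K₀ : Type*) [Field K₀] {K : Type*} [Field K] [Algebra K₀ K]
    (v : AbsoluteValue K ℝ) : ℝ :=
  (localDegree K₀ v : ℝ) / (Module.finrank K₀ K : ℝ)

end Places

/-! ### The projective line -/

/-- The projective line over a field `L`. -/
abbrev P1 (L : Type*) [Field L] : Type _ := ℙ L (Fin 2 → L)

/-- `ℙ¹(L)` carries the quotient topology from `L² ∖ {0}`. -/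
instance P1.instTopologicalSpace (L : Type*) [Field L] [TopologicalSpace L] :
    TopologicalSpace (P1 L) :=
  TopologicalSpace.coinduced (Projectivization.mk' L (V := Fin 2 → L)) inferInstance

/-- The map `ℙ¹(K) → ℙ¹(L)` induced by a field embedding `K → L`. -/
def P1.map {K L : Type*} [Field K] [Field L] (σ : K →+* L) : P1 K → P1 L :=
  Projectivization.map
    ({ toFun := fun x i => σ (x i)
       map_add' := fun x y => funext fun i => map_add σ (x i) (y i)
       map_smul' := fun c x => funext fun i => map_mul σ c (x i) } :
      (Fin 2 → K) →ₛₗ[σ] (Fin 2 → L))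
    (fun _ _ h => funext fun i => σ.injective (congrFun h i))

/-- The absolute logarithmic Weil height on `ℙ¹(K)`, `h([x,y]) = ∑ n_v log max(|x|_v, |y|_v)`;
by the product formula the choice of homogeneous coordinates is irrelevant. -/
def weilHeight {K₀ : Type*} [Field K₀] (M₀ : Set (AbsoluteValue K₀ ℝ)) {K : Type*} [Field K]
    [Algebra K₀ K] (P : P1 K) : ℝ :=
  ∑ᶠ v : Place M₀ K, weight K₀ v.1 * Real.log (max (v.1 (P.rep 0)) (v.1 (P.rep 1)))

/-! ### Endomorphisms of the projective line and their lifts -/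

/-- A lift `𝔸² → 𝔸²` over `K` of an endomorphism of `ℙ¹` of degree `degree`: a pair of forms of that
degree over `K` that have no common zero in `ℙ¹` over the algebraic closure of `K`. -/
structure Lift (K : Type*) [Field K] where
  degree : ℕ
  form : Fin 2 → MvPolynomial (Fin 2) K
  homogeneous : ∀ i, (form i).IsHomogeneous degree
  eq_zero_of_forall : ∀ x : Fin 2 → AlgebraicClosure K,
    (∀ i, MvPolynomial.aeval x (form i) = 0) → x = 0

namespace Lift

variable {K : Type*} [Field K]

/-- The map `L² → L²` given by a lift, for a field `L` containing `K`. -/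
def eval (f : Lift K) {L : Type*} [Field L] (σ : K →+* L) (x : Fin 2 → L) : Fin 2 → L :=
  fun i => MvPolynomial.eval₂ σ x (f.form i)

theorem eval_ne_zero (f : Lift K) {x : Fin 2 → K} (hx : x ≠ 0) :
    f.eval (RingHom.id K) x ≠ 0 := by
  intro h
  apply hx
  have h2 : (fun i => algebraMap K (AlgebraicClosure K) (x i)) = 0 := by
    apply f.eq_zero_of_forall
    intro i
    have h1 : MvPolynomial.eval x (f.form i) = 0 := congrFun h i
    have h3 := MvPolynomial.aeval_algebraMap_apply (AlgebraicClosure K) x (f.form i)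
    rw [MvPolynomial.aeval_eq_eval] at h3
    exact h3.trans (by rw [h1, map_zero])
  funext i
  have h3 := congrFun h2 i
  simpa using h3

theorem eval_smul (f : Lift K) {L : Type*} [Field L] (σ : K →+* L) (c : L) (x : Fin 2 → L) :
    f.eval σ (c • x) = c ^ f.degree • f.eval σ x := by
  funext i
  simp only [eval, Pi.smul_apply, smul_eq_mul, MvPolynomial.eval₂_eq', Finset.mul_sum]
  refine Finset.sum_congr rfl fun d hd => ?_
  have h1 : ∑ j, d j = f.degree := by
    have h2 := f.homogeneous i (MvPolynomial.mem_support_iff.1 hd)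
    rw [← h2, Finsupp.weight_apply, Finsupp.sum_fintype _ _ (by simp)]
    simp
  simp only [mul_pow, Finset.prod_mul_distrib, Finset.prod_pow_eq_pow_sum, h1]
  ring

/-- Two lifts define the same endomorphism of `ℙ¹` iff they are proportional. -/
instance setoid (K : Type*) [Field K] : Setoid (Lift K) where
  r f g := f.degree = g.degree ∧ ∃ c : K, c ≠ 0 ∧ ∀ i, g.form i = MvPolynomial.C c * f.form i
  iseqv :=
    { refl := fun f => ⟨rfl, 1, one_ne_zero, fun i => by simp⟩
      symm := by
        rintro f g ⟨h, c, hc, hfg⟩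
        refine ⟨h.symm, c⁻¹, inv_ne_zero hc, fun i => ?_⟩
        rw [hfg i, ← mul_assoc, ← map_mul, inv_mul_cancel₀ hc, map_one, one_mul]
      trans := by
        rintro f g k ⟨h, c, hc, hfg⟩ ⟨h', d, hd, hgk⟩
        refine ⟨h.trans h', d * c, mul_ne_zero hd hc, fun i => ?_⟩
        rw [hgk i, hfg i, map_mul, mul_assoc] }

/-- The self-map of `ℙ¹(K)` given by a lift. -/
def toMap (f : Lift K) : P1 K → P1 K :=
  Projectivization.lift
    (fun x => Projectivization.mk K (f.eval (RingHom.id K) x.1) (f.eval_ne_zero x.2))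
    (by
      rintro ⟨a, ha⟩ ⟨b, hb⟩ t h
      simp only at h
      subst h
      exact (Projectivization.mk_eq_mk_iff' K _ _ _ _).2
        ⟨t ^ f.degree, (f.eval_smul (RingHom.id K) t b).symm⟩)

end Lift

/-- Endomorphisms of `ℙ¹` defined over `K`: pairs of forms of the same degree without common zero,
up to proportionality. -/
def Endo (K : Type*) [Field K] : Type _ := Quotient (Lift.setoid K)

namespace Endo

variable {K : Type*} [Field K]

/-- The endomorphism of `ℙ¹` defined by a lift. -/
def ofLift (f : Lift K) : Endo K := Quotient.mk (Lift.setoid K) f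

/-- The degree of an endomorphism of `ℙ¹`. -/
def degree (φ : Endo K) : ℕ := Quotient.lift (s := Lift.setoid K) Lift.degree (fun _ _ h => h.1) φ

/-- The self-map of `ℙ¹(K)` given by an endomorphism of `ℙ¹` over `K`. -/
def toMap (φ : Endo K) : P1 K → P1 K :=
  Quotient.lift (s := Lift.setoid K) Lift.toMap
    (by
      rintro f g ⟨-, c, hc, hfg⟩
      funext P
      induction P using Projectivization.ind with
      | h x hx =>
        refine (Projectivization.mk_eq_mk_iff' K _ _ _ _).2 ⟨c⁻¹, ?_⟩
        funext i
        simp [Lift.eval, hfg i, inv_mul_cancel_left₀ hc]) φ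

end Endo

/-! ### Sequences of maps -/

section Dynamics

variable {K : Type*} [Field K]

/-- `γ_n · P = (θ_n ∘ ⋯ ∘ θ_1)(P)` for the sequence `γ = (θ_1, θ_2, …)`, where `θ_{n+1} = γ n`. -/
def orbit (γ : ℕ → Endo K) : ℕ → P1 K → P1 K
  | 0, P => P
  | n + 1, P => (γ n).toMap (orbit γ n P)

/-- `γ̃_n (x) = (θ̃_n ∘ ⋯ ∘ θ̃_1)(x)` for the sequence of lifts `γ̃ = (θ̃_1, θ̃_2, …)`, where
`θ̃_{n+1} = γ̃ n`, as a self-map of `L²` for a field `L` containing `K`. -/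
def liftOrbit (γt : ℕ → Lift K) {L : Type*} [Field L] (σ : K →+* L) :
    ℕ → (Fin 2 → L) → (Fin 2 → L)
  | 0, x => x
  | n + 1, x => (γt n).eval σ (liftOrbit γt σ n x)

/-- `h(γ_n · P) / deg γ_n`, with `deg γ_n = ∏_{i ≤ n} deg θ_i`. -/
def heightSeq {K₀ : Type*} [Field K₀] (M₀ : Set (AbsoluteValue K₀ ℝ)) [Algebra K₀ K]
    (γ : ℕ → Endo K) (P : P1 K) (n : ℕ) : ℝ :=
  weilHeight M₀ (orbit γ n P) / ∏ i ∈ Finset.range n, ((γ i).degree : ℝ)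

/-- The canonical height `ĥ_γ(P) = lim h(γ_n · P) / deg γ_n`. -/
def canonicalHeight {K₀ : Type*} [Field K₀] (M₀ : Set (AbsoluteValue K₀ ℝ)) [Algebra K₀ K]
    (γ : ℕ → Endo K) (P : P1 K) : ℝ :=
  limUnder atTop (heightSeq M₀ γ P)

/-- `log ‖γ̃_n (x)‖_v / deg γ̃_n`, with the maximum norm on `K_v²`. -/
def greenSeq (v : AbsoluteValue K ℝ) (γt : ℕ → Lift K) (x : Fin 2 → v.Completion) (n : ℕ) : ℝ :=
  Real.log ‖liftOrbit γt (toCompletion v) n x‖ / ∏ i ∈ Finset.range n, ((γt i).degree : ℝ)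

/-- The Green function `G_{v,γ̃}(x) = lim log ‖γ̃_n (x)‖_v / deg γ̃_n` on `K_v² ∖ {0}`. -/
def green (v : AbsoluteValue K ℝ) (γt : ℕ → Lift K) (x : Fin 2 → v.Completion) : ℝ :=
  limUnder atTop (greenSeq v γt x)

/-- The value in `K_v` of a form over `K` at a vector of `K_v²`. -/
def evalAt (v : AbsoluteValue K ℝ) (E : MvPolynomial (Fin 2) K) (x : Fin 2 → v.Completion) :
    v.Completion :=
  MvPolynomial.eval₂ (toCompletion v) x E

/-- The local canonical height `λ̂_{v,γ̃,E}([x]) = e G_{v,γ̃}(x) - log |E(x)|_v`, computed from a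
chosen representative; it is meaningful where `E` does not vanish. -/
def localHeight (v : AbsoluteValue K ℝ) (γt : ℕ → Lift K) (E : MvPolynomial (Fin 2) K) (e : ℕ)
    (P : P1 v.Completion) : ℝ :=
  e * green v γt P.rep - Real.log ‖evalAt v E P.rep‖

end Dynamics

end

end LocalHeights

/-!
The Green function exists because consecutive terms of the sequence `log ‖γ̃_n x‖_v / deg γ̃_n` differ
by at most `C / 2 ^ (n + 1)`, where `C` bounds `|log ‖F x‖ - d log ‖x‖|` over the finitely many lifts
`F` in use, `d = deg F` (`Lift.exists_log_bound`). The lower bound for `‖F x‖` in this estimate comes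
from the Nullstellensatz: powers of the coordinates are combinations, over `K`, of the two forms of
`F` (`Lift.exists_X_pow_eq`). The convergence is uniform on `K_v² ∖ {0}`, so `G - log ‖·‖` is
continuous and bounded, and it descends to `ℙ¹(K_v)` because `G(c x) = log |c| + G(x)`. The extension
asked for in the second claim is `e` times this function, whatever `E` is.

For the global formula, at almost all places `v` the absolute value is nonarchimedean and the
coefficients of the lifts and of the Nullstellensatz identities are integral, so that the lifts
preserve the vectors of norm one (`Lift.finite_setOf_bad`). For a given point, all the local terms
`log ‖γ̃_n x‖_v` therefore vanish outside one finite set of places that does not depend on `n`, and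
the limit of `h(γ_n P) / deg γ_n` is a finite sum of local limits. The term `log |E(x)|_v` contributes
nothing, by the product formula.

The product formula on `K`, with the weights `[K_v : (K₀)_u] / [K : K₀]` (`finsum_weight_mul_log`), is
reduced to the one on `K₀` by the identity `∑_{v ∣ u} [K_v : (K₀)_u] log |x|_v = log |N x|_u`. Choose an
algebraically closed field `Ω` containing `(K₀)_u`, with an absolute value extending that of `(K₀)_u`:
an algebraic closure with the spectral norm if `u` is nonarchimedean, and `ℂ` for the real place of
`ℚ`. The norm `N x` is the product of `σ x` over the `K₀`-embeddings `σ : K → Ω`; each `σ` induces a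
place above `u`, and a place `v` is induced by exactly `[K_v : (K₀)_u]` of them, because these
embeddings are the restrictions of the `(K₀)_u`-embeddings `K_v → Ω` (`natCard_algHom_completion`). On
`K₀`, the fraction field of the factorial ring `ℤ` or `𝔽_p[t]`, the product formula has to be checked
on units and primes only, and at a prime exactly two standard absolute values differ from one.
-/

namespace LocalHeights

/-! ### Embeddings of a completion -/

section LocalDegree

theorem le_of_forall_pow_le_mul_pow {a b C : ℝ} (hb : 0 < b)
    (h : ∀ n : ℕ, a ^ n ≤ C * b ^ n) : a ≤ b := by
  by_contra! hab
  have h1 : 1 < a / b := (one_lt_div hb).2 hab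
  obtain ⟨n, hn⟩ := pow_unbounded_of_one_lt C h1
  have h2 := h n
  rw [div_pow, lt_div_iff₀ (by positivity)] at hn
  linarith

/-- An absolute value on a finite extension of a complete field is determined by its restriction:
all norms on a finite-dimensional space are equivalent, and comparing powers turns an inequality up
to a constant into an exact one. -/
theorem absoluteValue_eq_norm {L B : Type*} [NontriviallyNormedField L] [CompleteSpace L]
    [NormedField B] [NormedAlgebra L B] [FiniteDimensional L B] (w : AbsoluteValue B ℝ)
    (hw : ∀ x : L, w (algebraMap L B x) = ‖x‖) (b : B) : w b = ‖b‖ := by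
  let β := Module.finBasis L B
  let φ : B →L[L] (Fin (Module.finrank L B) → L) :=
    LinearMap.toContinuousLinearMap β.equivFun.toLinearMap
  obtain ⟨C, hC⟩ : ∃ C, ∀ b, w b ≤ C * ‖b‖ := by
    refine ⟨∑ i, ‖φ‖ * w (β i), fun b => ?_⟩
    have h1 : b = ∑ i, algebraMap L B (φ b i) * β i := by
      conv_lhs => rw [← β.sum_equivFun b]
      exact Finset.sum_congr rfl fun i _ => Algebra.smul_def _ _
    calc w b = w (∑ i, algebraMap L B (φ b i) * β i) := by rw [← h1]
      _ ≤ ∑ i, w (algebraMap L B (φ b i) * β i) := w.sum_le _ _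
      _ ≤ ∑ i, (‖φ‖ * w (β i)) * ‖b‖ := by
          refine Finset.sum_le_sum fun i _ => ?_
          rw [map_mul, hw]
          have h2 : ‖φ b i‖ ≤ ‖φ‖ * ‖b‖ := (norm_le_pi_norm _ i).trans (φ.le_opNorm b)
          nlinarith [w.nonneg (β i)]
      _ = _ := by rw [Finset.sum_mul]
  have key : ∀ b : B, b ≠ 0 → w b ≤ ‖b‖ := fun b hb =>
    le_of_forall_pow_le_mul_pow (C := C) (norm_pos_iff.2 hb) fun n => by
      simpa using hC (b ^ n)
  by_cases hb : b = 0
  · simp [hb]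
  refine le_antisymm (key b hb) ?_
  have h1 := key b⁻¹ (inv_ne_zero hb)
  rw [map_inv₀, norm_inv] at h1
  exact (inv_le_inv₀ (w.pos hb) (norm_pos_iff.2 hb)).1 h1

section Dense

variable {k K L B : Type*} [Field k] [Field K] [Algebra k K] [NontriviallyNormedField L]
  [CompleteSpace L] [NormedField B] [NormedAlgebra L B] {i : k →+* L} {j : K →+* B}

/-- The span over `L` of a basis of `K / k` is closed, since it is finite-dimensional, and dense. -/
theorem finiteDimensional_of_denseRange [FiniteDimensional k K] (hj : DenseRange j)
    (hij : ∀ x, algebraMap L B (i x) = j (algebraMap k K x)) : FiniteDimensional L B := by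
  let β := Module.finBasis k K
  let W : Submodule L B := Submodule.span L (Set.range fun n => j (β n))
  have : FiniteDimensional L W := FiniteDimensional.span_of_finite L (Set.finite_range _)
  have hW : IsClosed (W : Set B) := Submodule.closed_of_finiteDimensional W
  have hr : Set.range j ⊆ W := by
    rintro _ ⟨x, rfl⟩
    rw [← β.sum_equivFun x, map_sum]
    refine W.sum_mem fun n _ => ?_
    rw [Algebra.smul_def, map_mul, ← hij, ← Algebra.smul_def]
    exact W.smul_mem _ (Submodule.subset_span ⟨n, rfl⟩)
  have htop : W = ⊤ := by
    rw [eq_top_iff]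
    intro b _
    exact hW.closure_subset_iff.2 hr (hj b)
  exact Module.finite_def.2 (htop ▸ Submodule.fg_span (Set.finite_range _))

theorem adjoin_range_eq_top [FiniteDimensional L B] (hj : DenseRange j) :
    IntermediateField.adjoin L (Set.range j) = ⊤ := by
  have hW : IsClosed ((IntermediateField.adjoin L (Set.range j)).toSubalgebra.toSubmodule : Set B) :=
    Submodule.closed_of_finiteDimensional _
  rw [eq_top_iff]
  intro b _
  exact hW.closure_subset_iff.2 (IntermediateField.subset_adjoin L _) (hj b)

theorem isSeparable_of_denseRange [FiniteDimensional k K] [Algebra.IsSeparable k K]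
    (hj : DenseRange j) (hij : ∀ x, algebraMap L B (i x) = j (algebraMap k K x)) :
    Algebra.IsSeparable L B := by
  have := finiteDimensional_of_denseRange hj hij
  have h1 : Algebra.IsSeparable L (IntermediateField.adjoin L (Set.range j)) := by
    rw [IntermediateField.isSeparable_adjoin_iff_isSeparable]
    rintro _ ⟨x, rfl⟩
    refine Polynomial.Separable.of_dvd (Polynomial.Separable.map (f := i)
      (Algebra.IsSeparable.isSeparable k x)) ?_
    refine minpoly.dvd _ _ ?_
    have h2 : (algebraMap L B).comp i = j.comp (algebraMap k K) := RingHom.ext hij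
    rw [Polynomial.aeval_def, Polynomial.eval₂_map, h2, ← Polynomial.hom_eval₂,
      ← Polynomial.aeval_def, minpoly.aeval, map_zero]
  rw [adjoin_range_eq_top hj] at h1
  exact AlgEquiv.Algebra.isSeparable (IntermediateField.topEquiv (F := L) (E := B))

end Dense

theorem denseRange_toCompletion {K : Type*} [Field K] (v : AbsoluteValue K ℝ) :
    DenseRange (toCompletion v) := by
  intro b
  refine closure_mono ?_ (UniformSpace.Completion.denseRange_coe (α := WithAbs v) b)
  rintro _ ⟨x, rfl⟩
  exact ⟨WithAbs.equiv v x, rfl⟩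

/-- Let `Ω` be an algebraically closed extension of `L = k_u` with an absolute value `w` extending
that of `L`. The `k`-embeddings `K → Ω` that induce `v` on `K` are the restrictions of the
`L`-embeddings `K_v → Ω`, so there are `[K_v : L]` of them. -/
theorem natCard_algHom_completion {k K L Ω : Type*} [Field k] [Field K] [Algebra k K]
    [FiniteDimensional k K] [Algebra.IsSeparable k K] [NontriviallyNormedField L]
    [CompleteSpace L] (v : AbsoluteValue K ℝ) [NormedAlgebra L v.Completion] {i : k →+* L}
    (hi : DenseRange i)
    (hij : ∀ x, algebraMap L v.Completion (i x) = toCompletion v (algebraMap k K x))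
    [Field Ω] [IsAlgClosed Ω] [Algebra L Ω] [Algebra k Ω]
    (hΩ : ∀ x, algebraMap k Ω x = algebraMap L Ω (i x)) (w : AbsoluteValue Ω ℝ)
    (hw : ∀ x : L, w (algebraMap L Ω x) = ‖x‖) :
    Nat.card {σ : K →ₐ[k] Ω // ∀ x, w (σ x) = v x} = Module.finrank L v.Completion := by
  have hj := denseRange_toCompletion v
  have := finiteDimensional_of_denseRange hj hij
  have := isSeparable_of_denseRange hj hij
  have htop := adjoin_range_eq_top (L := L) hj
  rw [← AlgHom.card L v.Completion Ω, ← Nat.card_eq_fintype_card]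
  have hτ : ∀ (τ : v.Completion →ₐ[L] Ω) b, w (τ b) = ‖b‖ := fun τ b =>
    absoluteValue_eq_norm (L := L) (w.comp (f := τ.toRingHom) τ.toRingHom.injective)
      (fun x => by
        change w (τ (algebraMap L _ x)) = _
        rw [AlgHom.commutes, hw]) b
  symm
  refine Nat.card_eq_of_bijective (fun τ => ⟨⟨τ.toRingHom.comp (toCompletion v), fun x => ?_⟩,
    fun x => ?_⟩) ⟨?_, ?_⟩
  · change τ (toCompletion v (algebraMap k K x)) = _
    rw [← hij, AlgHom.commutes, hΩ]
  · change w (τ (toCompletion v x)) = _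
    rw [hτ, norm_toCompletion]
  · intro τ τ' h
    have h1 : ∀ x, τ (toCompletion v x) = τ' (toCompletion v x) := fun x =>
      DFunLike.congr_fun (Subtype.ext_iff.1 h) x
    have h2 : (τ.comp (IntermediateField.topEquiv (F := L) (E := v.Completion)).toAlgHom) =
        (τ'.comp (IntermediateField.topEquiv (F := L) (E := v.Completion)).toAlgHom) := by
      refine IntermediateField.algHom_ext_of_eq_adjoin L htop.symm ?_
      rintro _ ⟨x, rfl⟩
      exact h1 x
    ext b
    exact DFunLike.congr_fun h2 ⟨b, trivial⟩
  · rintro ⟨σ, hσ⟩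
    -- `σ` is isometric for `v` and `w`, so it extends to `K_v` with values in the finite extension
    -- of `L` generated by its image, which is complete.
    let _ : NormedField Ω := w.toNormedField
    let _ : NormedAlgebra L Ω :=
      { norm_smul_le := fun a b => by
          rw [Algebra.smul_def]
          change w (_ * _) ≤ ‖a‖ * w b
          rw [map_mul, hw] }
    let β := Module.finBasis k K
    let M : Subalgebra L Ω := Algebra.adjoin L (Set.range fun n => σ (β n))
    let _ : Algebra k L := i.toAlgebra
    have _ : IsScalarTower k L Ω := IsScalarTower.of_algebraMap_eq hΩ
    have hM : FiniteDimensional L M := by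
      refine Algebra.finite_adjoin_of_finite_of_isIntegral (Set.finite_range _) ?_
      rintro _ ⟨n, rfl⟩
      exact ((Algebra.IsIntegral.isIntegral (R := k) (β n)).map σ).tower_top
    have hσM : ∀ x, σ x ∈ M := fun x => by
      rw [← β.sum_equivFun x, map_sum]
      refine M.sum_mem fun n _ => ?_
      rw [map_smul, ← IsScalarTower.algebraMap_smul L]
      exact M.smul_mem (Algebra.subset_adjoin ⟨n, rfl⟩) _
    have hMc : CompleteSpace M := FiniteDimensional.complete L M
    let f : WithAbs v →+* M :=
      { toFun := fun x => ⟨σ (WithAbs.equiv v x), hσM _⟩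
        map_one' := by ext; simp
        map_mul' := fun x y => by ext; simp
        map_zero' := by ext; simp
        map_add' := fun x y => by ext; simp }
    have hf : Isometry f := AddMonoidHomClass.isometry_of_norm _ fun x => hσ _
    let τ := UniformSpace.Completion.extensionHom f hf.continuous
    have hτj : ∀ x : K, τ (toCompletion v x) = f ((WithAbs.equiv v).symm x) := fun x =>
      UniformSpace.Completion.extensionHom_coe f hf.continuous _
    have hτL : ∀ x : L, τ (algebraMap L v.Completion x) = algebraMap L M x := by
      have h1 : Continuous τ := UniformSpace.Completion.continuous_extension
      refine fun x => congrFun (hi.equalizer (h1.comp (algebraMapCLM L v.Completion).continuous)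
        (algebraMapCLM L M).continuous ?_) x
      funext x
      change τ (algebraMap L v.Completion (i x)) = algebraMap L M (i x)
      rw [hij, hτj]
      ext
      change σ (algebraMap k K x) = algebraMap L Ω (i x)
      rw [AlgHom.commutes, hΩ]
    refine ⟨M.val.comp ⟨τ, hτL⟩, ?_⟩
    ext x
    change ((τ (toCompletion v x) : M) : Ω) = σ x
    rw [hτj]
    rfl

end LocalDegree

/-! ### Places above a given absolute value and the norm -/

section Fibre

/-- The completion `k_u` embeds in an algebraically closed field with an absolute value that extends
the one of `k_u`. -/
def HasAlgClosedExtension {k : Type} [Field k] (u : AbsoluteValue k ℝ) : Prop :=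
  ∃ (Ω : Type) (_ : Field Ω) (_ : IsAlgClosed Ω) (_ : Algebra u.Completion Ω)
    (w : AbsoluteValue Ω ℝ), ∀ x : u.Completion, w (algebraMap u.Completion Ω x) = ‖x‖

/-- The completion at a nontrivial absolute value, as a nontrivially normed field. -/
@[reducible]
noncomputable def completionNontriviallyNormedField {k : Type*} [Field k] (u : AbsoluteValue k ℝ)
    (hu : u.IsNontrivial) : NontriviallyNormedField u.Completion :=
  { (inferInstance : NormedField u.Completion) with
    non_trivial := by
      obtain ⟨x, hx⟩ := hu.exists_abv_gt_one
      exact ⟨toCompletion u x, by rwa [norm_toCompletion]⟩ }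

theorem isometry_completionMap {k K : Type*} [Field k] [Field K] [Algebra k K]
    (v : AbsoluteValue K ℝ) : Isometry (completionMap k v) :=
  (isometry_map v).completion_map

/-- The local extension `K_v / k_u`, as an isometric extension of normed fields. -/
@[reducible]
noncomputable def completionNormedAlgebra {k K : Type*} [Field k] [Field K] [Algebra k K]
    (v : AbsoluteValue K ℝ) : NormedAlgebra (restrict k v).Completion v.Completion :=
  { (completionMap k v).toAlgebra with
    norm_smul_le := fun a b => by
      change ‖completionMap k v a * b‖ ≤ _
      rw [norm_mul, (isometry_completionMap v).norm_map_of_map_zero (map_zero _)] }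

theorem completionMap_toCompletion {k K : Type*} [Field k] [Field K] [Algebra k K]
    (v : AbsoluteValue K ℝ) (x : k) :
    completionMap k v (toCompletion (restrict k v) x) = toCompletion v (algebraMap k K x) :=
  UniformSpace.Completion.map_coe (isometry_map v).uniformContinuous _

theorem localDegree_pos {k K : Type*} [Field k] [Field K] [Algebra k K] [FiniteDimensional k K]
    {v : AbsoluteValue K ℝ} (hu : (restrict k v).IsNontrivial) : 0 < localDegree k v := by
  let _ := completionNontriviallyNormedField _ hu
  let _ := completionNormedAlgebra (k := k) v
  have : FiniteDimensional (restrict k v).Completion v.Completion :=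
    finiteDimensional_of_denseRange (i := toCompletion (restrict k v)) (denseRange_toCompletion v)
      (completionMap_toCompletion v)
  exact Module.finrank_pos (R := (restrict k v).Completion) (M := v.Completion)

theorem natCard_algHom_eq_localDegree {k K Ω : Type*} [Field k] [Field K] [Algebra k K]
    [FiniteDimensional k K] [Algebra.IsSeparable k K] {u : AbsoluteValue k ℝ}
    (hu : u.IsNontrivial) {v : AbsoluteValue K ℝ} (hv : restrict k v = u)
    [Field Ω] [IsAlgClosed Ω] [Algebra u.Completion Ω] [Algebra k Ω]
    (hΩ : ∀ x, algebraMap k Ω x = algebraMap u.Completion Ω (toCompletion u x))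
    (w : AbsoluteValue Ω ℝ) (hw : ∀ x : u.Completion, w (algebraMap u.Completion Ω x) = ‖x‖) :
    Nat.card {σ : K →ₐ[k] Ω // ∀ x, w (σ x) = v x} = localDegree k v := by
  subst hv
  let _ := completionNontriviallyNormedField _ hu
  let _ := completionNormedAlgebra (k := k) v
  exact natCard_algHom_completion v (denseRange_toCompletion (restrict k v))
    (completionMap_toCompletion v) hΩ w hw

/-- There are finitely many places `v` above `u`, and
`∑_{v ∣ u} [K_v : k_u] log |x|_v = log |N x|_u`: the embeddings of `K` in an algebraically closed
extension of `k_u` induce all these places, each one `[K_v : k_u]` times. -/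
theorem finite_fibre_and_finsum_log_eq {k : Type} {K : Type*} [Field k] [Field K] [Algebra k K]
    [FiniteDimensional k K] [Algebra.IsSeparable k K] {u : AbsoluteValue k ℝ}
    (hu : u.IsNontrivial) (hΩ : HasAlgClosedExtension u) :
    {v : AbsoluteValue K ℝ | restrict k v = u}.Finite ∧ ∀ x : K, x ≠ 0 →
      ∑ᶠ v ∈ {v : AbsoluteValue K ℝ | restrict k v = u}, (localDegree k v : ℝ) * Real.log (v x) =
        Real.log (u (Algebra.norm k x)) := by
  classical
  obtain ⟨Ω, _, _, _, w, hw⟩ := hΩ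
  let _ : Algebra k Ω := ((algebraMap u.Completion Ω).comp (toCompletion u)).toAlgebra
  have hkΩ : ∀ x, algebraMap k Ω x = algebraMap u.Completion Ω (toCompletion u x) := fun _ => rfl
  let g : (K →ₐ[k] Ω) → AbsoluteValue K ℝ := fun σ => w.comp (f := σ.toRingHom) σ.toRingHom.injective
  have hg : ∀ σ x, g σ x = w (σ x) := fun _ _ => rfl
  have hcard : ∀ v : AbsoluteValue K ℝ, restrict k v = u →
      (Finset.univ.filter fun σ => g σ = v).card = localDegree k v := by
    intro v hv
    rw [← natCard_algHom_eq_localDegree hu hv hkΩ w hw, Nat.card_eq_fintype_card,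
      Fintype.card_subtype]
    congr 1
    ext σ
    simp [AbsoluteValue.ext_iff, hg]
  have hset : {v : AbsoluteValue K ℝ | restrict k v = u} = ↑(Finset.univ.image g) := by
    ext v
    simp only [Set.mem_ofPred_eq, Finset.coe_image, Finset.coe_univ, Set.image_univ, Set.mem_range]
    constructor
    · intro hv
      have h1 : 0 < (Finset.univ.filter fun σ => g σ = v).card := by
        rw [hcard v hv]
        exact localDegree_pos (hv ▸ hu)
      obtain ⟨σ, hσ⟩ := Finset.card_pos.1 h1
      exact ⟨σ, (Finset.mem_filter.1 hσ).2⟩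
    · rintro ⟨σ, rfl⟩
      ext x
      change w (σ (algebraMap k K x)) = u x
      rw [AlgHom.commutes, hkΩ, hw, norm_toCompletion]
  refine ⟨hset ▸ Finset.finite_toSet _, fun x hx => ?_⟩
  rw [hset, finsum_mem_coe_finset]
  have h1 : u (Algebra.norm k x) = ∏ σ : K →ₐ[k] Ω, g σ x := by
    rw [← norm_toCompletion, ← hw, ← hkΩ, Algebra.norm_eq_prod_embeddings, map_prod]
    rfl
  rw [h1, Real.log_prod fun σ _ => (g σ).ne_zero hx,
    Finset.sum_comp (fun v : AbsoluteValue K ℝ => Real.log (v x)) g]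
  refine Finset.sum_congr rfl fun v hv => ?_
  have hv' : restrict k v = u := by
    have : v ∈ {v : AbsoluteValue K ℝ | restrict k v = u} := by rw [hset]; exact hv
    exact this
  rw [nsmul_eq_mul, hcard v hv']

theorem isUltrametricDist_completion {k : Type*} [Field k] {u : AbsoluteValue k ℝ}
    (h : ∀ n : ℕ, u n ≤ 1) : IsUltrametricDist u.Completion := by
  refine IsUltrametricDist.isUltrametricDist_of_forall_norm_natCast_le_one fun n => ?_
  have h1 := norm_toCompletion u (n : k)
  rw [map_natCast] at h1
  exact h1.trans_le (h n)

/-- The spectral norm extends the absolute value of `k_u` to an algebraic closure. -/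
theorem hasAlgClosedExtension_of_isNonarchimedean {k : Type} [Field k] {u : AbsoluteValue k ℝ}
    (hu : u.IsNontrivial) (h : ∀ n : ℕ, u n ≤ 1) : HasAlgClosedExtension u := by
  let _ := completionNontriviallyNormedField _ hu
  have := isUltrametricDist_completion h
  let s := spectralMulAlgNorm u.Completion (AlgebraicClosure u.Completion)
  refine ⟨AlgebraicClosure u.Completion, inferInstance, inferInstance, inferInstance,
    { toFun := s
      map_mul' := map_mul s
      nonneg' := apply_nonneg s
      eq_zero' := fun x => map_eq_zero_iff_eq_zero s
      add_le' := map_add_le_add s }, fun x => ?_⟩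
  exact spectralNorm_extends x

theorem hasAlgClosedExtension_real : HasAlgClosedExtension Rat.AbsoluteValue.real := by
  let f : WithAbs Rat.AbsoluteValue.real →+* ℂ := (algebraMap ℚ ℂ).comp (WithAbs.equiv _).toRingHom
  have hf : Isometry f := AddMonoidHomClass.isometry_of_norm _ fun x => by
    change ‖((WithAbs.equiv _ x : ℚ) : ℂ)‖ = Rat.AbsoluteValue.real (WithAbs.equiv _ x)
    simp
  let F := UniformSpace.Completion.extensionHom f hf.continuous
  have hF : Isometry F := hf.completion_extension
  refine ⟨ℂ, inferInstance, inferInstance, F.toAlgebra, NormedField.toAbsoluteValue ℂ, fun x => ?_⟩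
  exact hF.norm_map_of_map_zero (map_zero _) x

end Fibre

/-! ### The product formula on the base field -/

section Base

/-- A set of absolute values on a field satisfies the product formula: a nonzero element has value
one at almost all of them, and the product of its values is one. -/
structure HasProductFormula {k : Type*} [Field k] (M : Set (AbsoluteValue k ℝ)) : Prop where
  finite : ∀ x : k, x ≠ 0 → {u ∈ M | u x ≠ 1}.Finite
  finsum_log : ∀ x : k, x ≠ 0 → ∑ᶠ u ∈ M, Real.log (u x) = 0

/-- On the fraction field of a factorial ring, the product formula has to be checked on units and
on primes only. -/
theorem hasProductFormula_of_forall_prime (R : Type*) {k : Type*} [CommRing R] [IsDomain R]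
    [UniqueFactorizationMonoid R] [Field k] [Algebra R k] [IsFractionRing R k]
    {M : Set (AbsoluteValue k ℝ)}
    (hunit : ∀ r : R, IsUnit r → ∀ u ∈ M, u (algebraMap R k r) = 1)
    (hprime : ∀ q : R, Prime q → ∃ u₁ ∈ M, ∃ u₂ ∈ M, u₁ ≠ u₂ ∧
      u₁ (algebraMap R k q) * u₂ (algebraMap R k q) = 1 ∧
      ∀ u ∈ M, u ≠ u₁ → u ≠ u₂ → u (algebraMap R k q) = 1) :
    HasProductFormula M := by
  classical
  let Q : k → Prop := fun x => {u ∈ M | u x ≠ 1}.Finite ∧ ∑ᶠ u ∈ M, Real.log (u x) = 0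
  have hsupp : ∀ x : k, M ∩ Function.support (fun u : AbsoluteValue k ℝ => Real.log (u x)) ⊆
      {u ∈ M | u x ≠ 1} := by
    rintro x u ⟨hu, h⟩
    exact ⟨hu, fun h1 => h (by simp [h1])⟩
  have hmul : ∀ x y : k, x ≠ 0 → y ≠ 0 → Q x → Q y → Q (x * y) := by
    intro x y hx hy ⟨hx1, hx2⟩ ⟨hy1, hy2⟩
    refine ⟨(hx1.union hy1).subset ?_, ?_⟩
    · rintro u ⟨hu, h⟩
      by_contra h1
      simp only [Set.mem_union, Set.mem_ofPred_eq, hu, true_and, not_or, not_not] at h1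
      exact h (by rw [map_mul, h1.1, h1.2, one_mul])
    · have h1 : ∀ u : AbsoluteValue k ℝ, Real.log (u (x * y)) = Real.log (u x) + Real.log (u y) :=
        fun u => by rw [map_mul, Real.log_mul (u.ne_zero hx) (u.ne_zero hy)]
      simp only [h1]
      rw [finsum_mem_add_distrib' (hx1.subset (hsupp x)) (hy1.subset (hsupp y)), hx2, hy2, add_zero]
  have hinv : ∀ x : k, Q x → Q x⁻¹ := by
    intro x ⟨hx1, hx2⟩
    refine ⟨hx1.subset ?_, ?_⟩
    · rintro u ⟨hu, h⟩
      exact ⟨hu, fun h1 => h (by rw [map_inv₀, h1, inv_one])⟩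
    · have h1 : ∀ u : AbsoluteValue k ℝ, Real.log (u x⁻¹) = -Real.log (u x) :=
        fun u => by rw [map_inv₀, Real.log_inv]
      simp only [h1]
      have h2 := finsum_mem_add_distrib' (s := M) (f := fun u : AbsoluteValue k ℝ => Real.log (u x))
        (g := fun u => -Real.log (u x)) (hx1.subset (hsupp x))
        (by simpa [Function.support] using hx1.subset (hsupp x))
      simp only [add_neg_cancel, finsum_mem_zero, hx2, zero_add] at h2
      exact h2.symm
  have hR : ∀ r : R, r ≠ 0 → Q (algebraMap R k r) := by
    intro r
    induction r using UniqueFactorizationMonoid.induction_on_prime with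
    | h₁ => exact fun h => (h rfl).elim
    | h₂ r hr =>
      refine fun _ => ⟨?_, ?_⟩
      · convert Set.finite_empty
        ext u
        simp only [Set.mem_ofPred_eq, Set.mem_empty_iff_false, iff_false, not_and, not_not]
        exact hunit r hr u
      · exact finsum_mem_eq_zero_of_forall_eq_zero fun u hu => by rw [hunit r hr u hu, Real.log_one]
    | h₃ a q ha hq ih =>
      intro _
      have hinj := IsFractionRing.injective R k
      have hq0 : algebraMap R k q ≠ 0 := (map_ne_zero_iff _ hinj).2 hq.ne_zero
      rw [map_mul]
      refine hmul _ _ hq0 ((map_ne_zero_iff _ hinj).2 ha) ?_ (ih ha)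
      obtain ⟨u₁, h1, u₂, h2, hne, h12, h⟩ := hprime q hq
      have hsub : {u ∈ M | u (algebraMap R k q) ≠ 1} ⊆ {u₁, u₂} := by
        rintro u ⟨hu, hu1⟩
        by_contra hu2
        simp only [Set.mem_insert_iff, Set.mem_singleton_iff, not_or] at hu2
        exact hu1 (h u hu hu2.1 hu2.2)
      refine ⟨(Set.toFinite _).subset hsub, ?_⟩
      rw [finsum_mem_eq_sum_of_inter_support_eq (s := M) (t := {u₁, u₂})
        (fun u : AbsoluteValue k ℝ => Real.log (u (algebraMap R k q))), Finset.sum_pair hne,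
        ← Real.log_mul (u₁.ne_zero hq0) (u₂.ne_zero hq0), h12, Real.log_one]
      ext u
      simp only [Finset.coe_insert, Finset.coe_singleton]
      refine ⟨fun hu => ⟨hsub (hsupp _ hu), hu.2⟩, fun hu => ⟨?_, hu.2⟩⟩
      rcases hu.1 with rfl | rfl <;> assumption
  have key : ∀ x : k, x ≠ 0 → Q x := by
    intro x hx
    obtain ⟨a, b, hb, rfl⟩ := IsFractionRing.div_surjective (A := R) x
    have ha : a ≠ 0 := by
      rintro rfl
      simp at hx
    have hb := nonZeroDivisors.ne_zero hb
    have hinj := IsFractionRing.injective R k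
    rw [div_eq_mul_inv]
    exact hmul _ _ ((map_ne_zero_iff _ hinj).2 ha) (inv_ne_zero ((map_ne_zero_iff _ hinj).2 hb))
      (hR a ha) (hinv _ (hR b hb))
  exact ⟨fun x hx => (key x hx).1, fun x hx => (key x hx).2⟩

theorem hasProductFormula_ratAbs : HasProductFormula ratAbs := by
  refine hasProductFormula_of_forall_prime ℤ ?_ ?_
  · intro r hr u _
    rcases Int.isUnit_iff.1 hr with rfl | rfl <;> simp
  · intro q hq
    obtain ⟨p, hpq⟩ : ∃ p : ℕ, p = q.natAbs := ⟨_, rfl⟩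
    have hp : p.Prime := hpq ▸ Int.prime_iff_natAbs_prime.1 hq
    have hval : ∀ u : AbsoluteValue ℚ ℝ, u (algebraMap ℤ ℚ q) = u (p : ℚ) := by
      intro u
      rcases Int.natAbs_eq q with h | h <;> rw [h, ← hpq] <;> simp
    simp only [hval]
    have := Fact.mk hp
    have hp0 : (p : ℝ) ≠ 0 := by exact_mod_cast hp.ne_zero
    have h1 : Rat.AbsoluteValue.real (p : ℚ) = p := by simp
    have h2 : Rat.AbsoluteValue.padic p (p : ℚ) = (p : ℝ)⁻¹ := by simp
    refine ⟨_, Or.inl rfl, Rat.AbsoluteValue.padic p, Or.inr ⟨p, this, rfl⟩, ?_, ?_, ?_⟩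
    · intro h
      have h3 : (1 : ℝ) < p := by exact_mod_cast hp.one_lt
      have h4 := inv_lt_one_of_one_lt₀ h3
      rw [← h2, ← h, h1] at h4
      linarith
    · rw [h1, h2, mul_inv_cancel₀ hp0]
    · rintro u (rfl | ⟨l, hl, rfl⟩) hu1 hu2
      · exact (hu1 rfl).elim
      · have hlp : l ≠ p := by
          rintro rfl
          exact hu2 rfl
        rw [Rat.AbsoluteValue.padic_eq_padicNorm]
        have h5 : padicNorm l (p : ℚ) = 1 := by
          rw [padicNorm.nat_eq_one_iff]
          exact fun h => hlp ((Nat.prime_dvd_prime_iff_eq hl.out hp).1 h)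
        rw [h5, Rat.cast_one]

section RatFunc

variable (p : ℕ) [Fact p.Prime]

open Polynomial

open Classical in
/-- The absolute value at infinity of `𝔽_p(t)`. -/
noncomputable def ratFuncInfty : AbsoluteValue (RatFunc (ZMod p)) ℝ where
  toFun x := if x = 0 then 0 else (p : ℝ) ^ x.intDegree
  map_mul' x y := by
    have hp : (p : ℝ) ≠ 0 := by exact_mod_cast (Fact.out : p.Prime).ne_zero
    by_cases hx : x = 0
    · simp [hx]
    by_cases hy : y = 0
    · simp [hy]
    simp [hx, hy, RatFunc.intDegree_mul hx hy, zpow_add₀ hp]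
  nonneg' x := by split_ifs <;> positivity
  eq_zero' x := by
    have hp : (p : ℝ) ≠ 0 := by exact_mod_cast (Fact.out : p.Prime).ne_zero
    by_cases hx : x = 0
    · simp [hx]
    · simpa [hx] using zpow_ne_zero _ hp
  add_le' x y := by
    have hp : (1 : ℝ) ≤ p := by exact_mod_cast (Fact.out : p.Prime).one_le
    by_cases hx : x = 0
    · simp [hx]
    by_cases hy : y = 0
    · simp [hy]
    simp only [hx, hy, if_false]
    by_cases hxy : x + y = 0
    · simp only [hxy, if_true]
      positivity
    · simp only [hxy, if_false]
      refine (zpow_le_zpow_right₀ hp (RatFunc.intDegree_add_le hy hxy)).trans ?_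
      rcases le_total x.intDegree y.intDegree with h | h
      · rw [max_eq_right h]
        exact le_add_of_nonneg_left (by positivity)
      · rw [max_eq_left h]
        exact le_add_of_nonneg_right (by positivity)

theorem ratFuncInfty_algebraMap {f : (ZMod p)[X]} (hf : f ≠ 0) :
    ratFuncInfty p (algebraMap (ZMod p)[X] (RatFunc (ZMod p)) f) = (p : ℝ) ^ f.natDegree := by
  have h : algebraMap (ZMod p)[X] (RatFunc (ZMod p)) f ≠ 0 := by simpa using hf
  classical
  change (if algebraMap (ZMod p)[X] (RatFunc (ZMod p)) f = 0 then (0 : ℝ) else _) = _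
  rw [if_neg h, RatFunc.intDegree_polynomial, zpow_natCast]

theorem exists_ratFuncAbs_adic {π : (ZMod p)[X]} (hπ : Irreducible π) :
    ∃ u : AbsoluteValue (RatFunc (ZMod p)) ℝ, ∀ f : (ZMod p)[X], f ≠ 0 →
      u (algebraMap (ZMod p)[X] (RatFunc (ZMod p)) f) =
        ((p : ℝ) ^ (π.natDegree * multiplicity π f))⁻¹ := by
  have hp : 1 < p := (Fact.out : p.Prime).one_lt
  have hb : (1 : NNReal) < (p : NNReal) ^ π.natDegree :=
    one_lt_pow₀ (by exact_mod_cast hp) hπ.natDegree_pos.ne'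
  let v : IsDedekindDomain.HeightOneSpectrum (ZMod p)[X] :=
    { asIdeal := Ideal.span {π}
      isPrime := (Ideal.span_singleton_prime hπ.ne_zero).2 hπ.prime
      ne_bot := by simpa using hπ.ne_zero }
  refine ⟨v.adicAbv hb, fun f hf => ?_⟩
  have hfin : FiniteMultiplicity π f := FiniteMultiplicity.of_not_isUnit hπ.not_isUnit hf
  obtain ⟨g, hg, hπg⟩ := hfin.exists_eq_pow_mul_and_not_dvd
  have h1 : v.adicAbv hb (algebraMap (ZMod p)[X] (RatFunc (ZMod p)) g) = 1 := by
    rw [v.adicAbv_coe_eq_one_iff, Ideal.mem_span_singleton]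
    exact hπg
  have h2 : v.adicAbv hb (algebraMap (ZMod p)[X] (RatFunc (ZMod p)) π) =
      ((p : ℝ) ^ π.natDegree)⁻¹ := by
    rw [v.adicAbv_of_algebraMap]
    change ((WithZeroMulInt.toNNReal (ne_zero_of_lt hb) (v.intValuation π) : NNReal) : ℝ) = _
    rw [v.intValuation_singleton hπ.ne_zero rfl, WithZeroMulInt.toNNReal_neg_apply (ne_zero_of_lt hb) (by simp)]
    push_cast
    exact zpow_neg_one _
  conv_lhs => rw [hg]
  rw [map_mul, map_mul, map_pow, map_pow, h1, h2, mul_one, inv_pow, pow_mul]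

theorem hasProductFormula_ratFuncAbs : HasProductFormula (ratFuncAbs p) := by
  have hp : (1 : ℝ) < p := by exact_mod_cast (Fact.out : p.Prime).one_lt
  refine hasProductFormula_of_forall_prime (ZMod p)[X] ?_ ?_
  · rintro r hr u (hu | ⟨π, -, hπ, hu⟩)
    · rw [hu r hr.ne_zero, Polynomial.natDegree_eq_zero_of_isUnit hr, pow_zero]
    · have h1 : multiplicity π r = 0 :=
        multiplicity_eq_zero.2 fun h => hπ.not_isUnit (isUnit_of_dvd_unit h hr)
      rw [hu r hr.ne_zero, h1, mul_zero, pow_zero, inv_one]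
  · intro q hq
    let π := normalize q
    have hass : Associated π q := (associated_normalize q).symm
    have hπ : Irreducible π := hass.symm.irreducible hq.irreducible
    have hmonic : π.Monic := Polynomial.monic_normalize hq.ne_zero
    obtain ⟨u₂, hu₂⟩ := exists_ratFuncAbs_adic p hπ
    have hdeg : π.natDegree = q.natDegree := Polynomial.natDegree_eq_of_degree_eq (by
      simp [π])
    have hmult : multiplicity π q = 1 := by
      rw [← multiplicity_eq_of_associated_right hass]
      exact multiplicity_self
    have hpos : (1 : ℝ) < p ^ q.natDegree := one_lt_pow₀ hp hq.irreducible.natDegree_pos.ne'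
    have h1 := ratFuncInfty_algebraMap p hq.ne_zero
    have h2 := hu₂ q hq.ne_zero
    rw [hmult, mul_one, hdeg] at h2
    refine ⟨ratFuncInfty p, Or.inl fun f hf => ratFuncInfty_algebraMap p hf, u₂,
      Or.inr ⟨π, hmonic, hπ, hu₂⟩, ?_, ?_, ?_⟩
    · intro h
      have h4 := inv_lt_one_of_one_lt₀ hpos
      rw [← h2, ← h, h1] at h4
      linarith
    · rw [h1, h2, mul_inv_cancel₀ (by positivity)]
    · have hext : ∀ u u' : AbsoluteValue (RatFunc (ZMod p)) ℝ, (∀ f : (ZMod p)[X], f ≠ 0 →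
          u (algebraMap _ _ f) = u' (algebraMap _ _ f)) → u = u' := by
        intro u u' h
        have h' : ∀ f : (ZMod p)[X], u (algebraMap _ _ f) = u' (algebraMap _ _ f) := by
          intro f
          by_cases hf : f = 0
          · simp [hf]
          · exact h f hf
        ext x
        obtain ⟨a, b, -, rfl⟩ := IsFractionRing.div_surjective (A := (ZMod p)[X]) x
        rw [map_div₀, map_div₀, h', h']
      rintro u (hu | ⟨ρ, hρm, hρ, hu⟩) hu1 hu2
      · exact (hu1 (hext _ _ fun f hf => (hu f hf).trans (ratFuncInfty_algebraMap p hf).symm)).elim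
      · have h0 : multiplicity ρ q = 0 := by
          refine multiplicity_eq_zero.2 fun h => hu2 ?_
          have hρπ : ρ = π := Polynomial.eq_of_monic_of_associated hρm hmonic
            ((hρ.associated_of_dvd hq.irreducible h).trans hass.symm)
          exact hext _ _ fun f hf => by rw [hu f hf, hu₂ f hf, hρπ]
        rw [hu q hq.ne_zero, h0, mul_zero, pow_zero, inv_one]

end RatFunc

variable {k : Type} [Field k] {M : Set (AbsoluteValue k ℝ)}

theorem IsGlobalBase.hasProductFormula (h : IsGlobalBase k M) : HasProductFormula M := by
  cases h with
  | rat => exact hasProductFormula_ratAbs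
  | ratFunc p => exact hasProductFormula_ratFuncAbs p

theorem natCast_le_one_of_mem_ratFuncAbs (p : ℕ) [Fact p.Prime]
    {u : AbsoluteValue (RatFunc (ZMod p)) ℝ} (hu : u ∈ ratFuncAbs p) (n : ℕ) : u n ≤ 1 := by
  have hp : (1 : ℝ) < p := by exact_mod_cast (Fact.out : p.Prime).one_lt
  by_cases hn : (n : Polynomial (ZMod p)) = 0
  · rw [← map_natCast (algebraMap (Polynomial (ZMod p)) (RatFunc (ZMod p))), hn]
    simp
  · rw [← map_natCast (algebraMap (Polynomial (ZMod p)) (RatFunc (ZMod p)))]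
    rcases hu with hu | ⟨π, -, hπ, hu⟩
    · rw [hu _ hn]
      simp
    · rw [hu _ hn]
      exact inv_le_one_of_one_le₀ (one_le_pow₀ hp.le)

theorem IsGlobalBase.finite_archimedean (h : IsGlobalBase k M) :
    {u ∈ M | ¬ ∀ n : ℕ, u n ≤ 1}.Finite := by
  cases h with
  | rat =>
    refine (Set.finite_singleton Rat.AbsoluteValue.real).subset ?_
    rintro u ⟨rfl | ⟨p, hp, rfl⟩, h⟩
    · rfl
    · exact (h fun n => Rat.AbsoluteValue.padic_le_one p n).elim
  | ratFunc p =>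
    convert Set.finite_empty
    ext u
    simp only [Set.mem_ofPred_eq, Set.mem_empty_iff_false, iff_false, not_and, not_not]
    exact fun hu n => natCast_le_one_of_mem_ratFuncAbs p hu n

theorem IsGlobalBase.isNontrivial (h : IsGlobalBase k M) {u : AbsoluteValue k ℝ} (hu : u ∈ M) :
    u.IsNontrivial := by
  cases h with
  | rat =>
    rcases hu with rfl | ⟨p, hp, rfl⟩
    · exact ⟨2, by norm_num, by norm_num⟩
    · have hp1 : (1 : ℝ) < p := by exact_mod_cast hp.out.one_lt
      refine ⟨p, by exact_mod_cast hp.out.ne_zero, ?_⟩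
      simpa using hp1.ne'
  | ratFunc p =>
    have hp : (1 : ℝ) < p := by exact_mod_cast (Fact.out : p.Prime).one_lt
    rcases hu with hu | ⟨π, -, hπ, hu⟩
    · refine ⟨algebraMap (Polynomial (ZMod p)) _ Polynomial.X, by simpa using RatFunc.X_ne_zero, ?_⟩
      rw [hu _ Polynomial.X_ne_zero]
      simpa using hp.ne'
    · refine ⟨algebraMap (Polynomial (ZMod p)) _ π, by simpa using hπ.ne_zero, ?_⟩
      have h1 : multiplicity π π = 1 := multiplicity_self
      rw [hu _ hπ.ne_zero, h1, mul_one]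
      exact (inv_lt_one_of_one_lt₀ (one_lt_pow₀ hp hπ.natDegree_pos.ne')).ne

theorem IsGlobalBase.hasAlgClosedExtension (h : IsGlobalBase k M) {u : AbsoluteValue k ℝ}
    (hu : u ∈ M) : HasAlgClosedExtension u := by
  by_cases h1 : ∀ n : ℕ, u n ≤ 1
  · exact hasAlgClosedExtension_of_isNonarchimedean (h.isNontrivial hu) h1
  · cases h with
    | rat =>
      rcases hu with rfl | ⟨p, hp, rfl⟩
      · exact hasAlgClosedExtension_real
      · exact (h1 fun n => Rat.AbsoluteValue.padic_le_one p n).elim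
    | ratFunc p => exact (h1 fun n => natCast_le_one_of_mem_ratFuncAbs p hu n).elim

end Base

/-! ### The product formula on a global field -/

section Global

theorem norm_le_one_of_monic_of_isRoot {F : Type*} [NormedField F] [IsUltrametricDist F]
    {q : Polynomial F} (hq : q.Monic) (hc : ∀ i, ‖q.coeff i‖ ≤ 1) {x : F} (hx : q.eval x = 0) :
    ‖x‖ ≤ 1 := by
  by_contra! h
  have hd : q.natDegree ≠ 0 := by
    intro h0
    rw [hq.natDegree_eq_zero.1 h0] at hx
    simp at hx
  obtain ⟨n, hn⟩ := Nat.exists_eq_succ_of_ne_zero hd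
  rw [Polynomial.eval_eq_sum_range, Finset.sum_range_succ, hq.coeff_natDegree, one_mul, hn,
    add_eq_zero_iff_neg_eq] at hx
  have h1 : ‖x‖ ^ (n + 1) ≤ ‖x‖ ^ n := by
    rw [← norm_pow, ← hx, norm_neg]
    refine IsUltrametricDist.norm_sum_le_of_forall_le_of_nonneg (by positivity) fun i hi => ?_
    rw [norm_mul, norm_pow]
    calc ‖q.coeff i‖ * ‖x‖ ^ i ≤ 1 * ‖x‖ ^ n :=
          mul_le_mul (hc i) (pow_le_pow_right₀ h.le (Nat.lt_succ_iff.1 (Finset.mem_range.1 hi)))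
            (by positivity) zero_le_one
      _ = _ := one_mul _
  exact absurd h1 (not_le.2 (pow_lt_pow_right₀ h (Nat.lt_succ_self n)))

theorem abs_le_one_of_minpoly {k K : Type*} [Field k] [Field K] [Algebra k K]
    [FiniteDimensional k K] {v : AbsoluteValue K ℝ} (hv : ∀ n : ℕ, v n ≤ 1) {x : K}
    (h : ∀ i, restrict k v ((minpoly k x).coeff i) ≤ 1) : v x ≤ 1 := by
  have := isUltrametricDist_completion hv
  rw [← norm_toCompletion]
  let σ : k →+* v.Completion := (toCompletion v).comp (algebraMap k K)
  refine norm_le_one_of_monic_of_isRoot (q := (minpoly k x).map σ)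
    ((minpoly.monic (Algebra.IsIntegral.isIntegral x)).map σ) (fun i => ?_) ?_
  · rw [Polynomial.coeff_map]
    exact (norm_toCompletion v _).trans_le (h i)
  · rw [Polynomial.eval_map, ← Polynomial.hom_eval₂, ← Polynomial.aeval_def, minpoly.aeval,
      map_zero]

variable {k : Type} [Field k] {M : Set (AbsoluteValue k ℝ)} (hM : IsGlobalBase k M)
  {K : Type*} [Field K] [Algebra k K] [FiniteDimensional k K] [Algebra.IsSeparable k K]

include hM

theorem finite_setOf_restrict_mem {T : Set (AbsoluteValue k ℝ)} (hT : T.Finite) (hTM : T ⊆ M) :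
    {v : AbsoluteValue K ℝ | restrict k v ∈ T}.Finite := by
  have h1 : {v : AbsoluteValue K ℝ | restrict k v ∈ T} =
      ⋃ u ∈ T, {v : AbsoluteValue K ℝ | restrict k v = u} := by
    ext v
    simp
  rw [h1]
  exact hT.biUnion fun u hu =>
    (finite_fibre_and_finsum_log_eq (hM.isNontrivial (hTM hu)) (hM.hasAlgClosedExtension (hTM hu))).1

theorem finite_setOf_not_natCast_le_one :
    {v : Place M K | ¬ ∀ n : ℕ, v.1 n ≤ 1}.Finite := by
  refine Set.Finite.of_finite_image ?_ Subtype.val_injective.injOn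
  refine (finite_setOf_restrict_mem hM hM.finite_archimedean (fun u hu => hu.1)).subset ?_
  rintro _ ⟨v, hv, rfl⟩
  refine ⟨v.2, fun h => hv fun n => ?_⟩
  have h1 := h n
  change v.1 (algebraMap k K n) ≤ 1 at h1
  rwa [map_natCast] at h1

/-- Outside the archimedean places and those where some nonzero coefficient of the minimal polynomial
of `x` has absolute value different from one, `x` is integral. -/
theorem finite_setOf_one_lt (x : K) : {v : Place M K | 1 < v.1 x}.Finite := by
  have hT : (⋃ i ∈ (minpoly k x).support, {u ∈ M | u ((minpoly k x).coeff i) ≠ 1}).Finite :=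
    (Finset.finite_toSet _).biUnion fun i hi =>
      hM.hasProductFormula.finite _ (Polynomial.mem_support_iff.1 hi)
  have h1 := finite_setOf_restrict_mem (K := K) hM hT (by
    intro u hu
    simp only [Set.mem_iUnion] at hu
    obtain ⟨i, hi, hu⟩ := hu
    exact hu.1)
  refine ((finite_setOf_not_natCast_le_one (K := K) hM).union
    (h1.preimage (f := Subtype.val) Subtype.val_injective.injOn)).subset ?_
  intro v hv
  by_contra hcon
  simp only [Set.mem_union, Set.mem_ofPred_eq, not_or, not_not, Set.mem_preimage, Set.mem_iUnion,
    not_exists] at hcon hv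
  refine not_le.2 hv (abs_le_one_of_minpoly (k := k) hcon.1 fun i => ?_)
  by_cases hi : (minpoly k x).coeff i = 0
  · simp [hi]
  · by_contra h2
    exact hcon.2 i (Polynomial.mem_support_iff.2 hi) ⟨v.2, fun h3 => h2 h3.le⟩

theorem finite_setOf_ne_one {x : K} (hx : x ≠ 0) : {v : Place M K | v.1 x ≠ 1}.Finite := by
  refine ((finite_setOf_one_lt hM x).union (finite_setOf_one_lt hM x⁻¹)).subset ?_
  intro v hv
  rcases lt_or_gt_of_ne hv with h | h
  · right
    change 1 < v.1 x⁻¹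
    rw [map_inv₀]
    exact (one_lt_inv₀ (v.1.pos hx)).2 h
  · exact Or.inl h

/-- The product formula on a global field, with the normalized local degrees as weights. -/
theorem finsum_weight_mul_log {x : K} (hx : x ≠ 0) :
    ∑ᶠ v : Place M K, weight k v.1 * Real.log (v.1 x) = 0 := by
  let f : AbsoluteValue K ℝ → ℝ := fun v => (localDegree k v : ℝ) * Real.log (v x)
  let s : Set (AbsoluteValue K ℝ) := {v | restrict k v ∈ M}
  suffices h : ∑ᶠ v ∈ s, f v = 0 by
    have h1 : ∀ v : Place M K, weight k v.1 * Real.log (v.1 x) =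
        (Module.finrank k K : ℝ)⁻¹ * f v.1 := fun v => by
      simp only [weight, f]
      ring
    simp only [h1]
    rw [← mul_finsum, finsum_subtype_eq_finsum_cond (fun v => restrict k v ∈ M)]
    exact mul_eq_zero_of_right _ h
  -- Both sums are restricted to the finite set `U` of absolute values of `k` below some `v` with
  -- `v x ≠ 1`; at the other `u` all the terms vanish, and with them `log |N x|_u`.
  let U : Set (AbsoluteValue k ℝ) :=
    (fun v : Place M K => restrict k v.1) '' {v : Place M K | v.1 x ≠ 1}
  have hU : U.Finite := (finite_setOf_ne_one hM hx).image _
  have hUM : U ⊆ M := by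
    rintro _ ⟨v, -, rfl⟩
    exact v.2
  have hfib := fun (u : AbsoluteValue k ℝ) (hu : u ∈ M) =>
    finite_fibre_and_finsum_log_eq (K := K) (hM.isNontrivial hu) (hM.hasAlgClosedExtension hu)
  have hone : ∀ v : AbsoluteValue K ℝ, restrict k v ∈ M → restrict k v ∉ U → f v = 0 := by
    intro v hv hvU
    have h1 : v x = 1 := by
      by_contra h
      exact hvU ⟨⟨v, hv⟩, h, rfl⟩
    simp [f, h1]
  have h1 : ∑ᶠ v ∈ s, f v = ∑ᶠ v ∈ ⋃ u ∈ U, {v : AbsoluteValue K ℝ | restrict k v = u}, f v := by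
    refine finsum_mem_inter_support_eq' _ _ _ fun v hv => ?_
    simp only [Set.mem_iUnion, exists_prop, Set.mem_ofPred_eq, s]
    refine ⟨fun hvM => ⟨_, ?_, rfl⟩, fun ⟨u, hu, hvu⟩ => hvu ▸ hUM hu⟩
    by_contra hvU
    exact hv (hone v hvM hvU)
  have h2 : ∑ᶠ u ∈ M, Real.log (u (Algebra.norm k x)) =
      ∑ᶠ u ∈ U, Real.log (u (Algebra.norm k x)) := by
    refine finsum_mem_inter_support_eq' _ _ _ fun u hu => ⟨fun huM => ?_, fun h => hUM h⟩
    by_contra huU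
    refine hu ?_
    simp only [← (hfib u huM).2 x hx]
    exact finsum_mem_eq_zero_of_forall_eq_zero fun v hv => by
      have hv' : restrict k v = u := hv
      exact hone v (hv' ▸ huM) (hv' ▸ huU)
  rw [h1, finsum_mem_biUnion _ hU fun u hu => (hfib u (hUM hu)).1]
  · rw [← hM.hasProductFormula.finsum_log (Algebra.norm k x) (by simpa using hx), h2]
    exact finsum_mem_congr rfl fun u hu => (hfib u (hUM hu)).2 x hx
  · intro u _ u' _ hne
    refine Set.disjoint_left.2 fun v hv hv' => hne ?_
    exact hv.symm.trans hv'

end Global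

/-! ### Local estimates for lifts and the Green function -/

section LocalBounds

theorem exists_norm_apply_eq_norm {L : Type*} [NormedField L] (x : Fin 2 → L) :
    ∃ i, ‖x i‖ = ‖x‖ := by
  obtain ⟨i, hi⟩ := Finite.exists_max fun i => ‖x i‖
  exact ⟨i, le_antisymm (norm_le_pi_norm x i) ((pi_norm_le_iff_of_nonneg (norm_nonneg _)).2 hi)⟩

theorem norm_toCompletion_comp {K : Type*} [Field K] (v : AbsoluteValue K ℝ) (x : Fin 2 → K) :
    ‖fun i => toCompletion v (x i)‖ = max (v (x 0)) (v (x 1)) := by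
  obtain ⟨i, hi⟩ := exists_norm_apply_eq_norm fun i => toCompletion v (x i)
  refine le_antisymm ?_ (max_le ?_ ?_)
  · rw [← hi, norm_toCompletion]
    fin_cases i
    · exact le_max_left _ _
    · exact le_max_right _ _
  · exact (norm_toCompletion v (x 0)).symm.trans_le
      (norm_le_pi_norm (fun i => toCompletion v (x i)) 0)
  · exact (norm_toCompletion v (x 1)).symm.trans_le
      (norm_le_pi_norm (fun i => toCompletion v (x i)) 1)

variable {K : Type*} [Field K] (v : AbsoluteValue K ℝ)

theorem norm_monomial_le_one {L : Type*} [NormedField L] {x : Fin 2 → L} (hx : ‖x‖ ≤ 1)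
    (d : Fin 2 →₀ ℕ) : ‖∏ i, x i ^ d i‖ ≤ 1 := by
  rw [norm_prod]
  refine Finset.prod_le_one (fun i _ => norm_nonneg _) fun i _ => ?_
  rw [norm_pow]
  exact pow_le_one₀ (norm_nonneg _) ((norm_le_pi_norm x i).trans hx)

theorem norm_evalAt_le (f : MvPolynomial (Fin 2) K) {x : Fin 2 → v.Completion} (hx : ‖x‖ ≤ 1) :
    ‖evalAt v f x‖ ≤ ∑ d ∈ f.support, v (f.coeff d) := by
  rw [evalAt, MvPolynomial.eval₂_eq']
  refine (norm_sum_le _ _).trans (Finset.sum_le_sum fun d _ => ?_)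
  rw [norm_mul, norm_toCompletion]
  exact mul_le_of_le_one_right (v.nonneg _) (norm_monomial_le_one hx d)

theorem norm_evalAt_le_one (hv : ∀ n : ℕ, v n ≤ 1) {f : MvPolynomial (Fin 2) K}
    (hf : ∀ d, v (f.coeff d) ≤ 1) {x : Fin 2 → v.Completion} (hx : ‖x‖ ≤ 1) :
    ‖evalAt v f x‖ ≤ 1 := by
  have := isUltrametricDist_completion hv
  rw [evalAt, MvPolynomial.eval₂_eq']
  refine IsUltrametricDist.norm_sum_le_of_forall_le_of_nonneg zero_le_one fun d _ => ?_
  rw [norm_mul, norm_toCompletion]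
  exact mul_le_one₀ (hf d) (norm_nonneg _) (norm_monomial_le_one hx d)

/-- By the Nullstellensatz, powers of the coordinates lie in the ideal generated by the two forms of
a lift. -/
theorem Lift.exists_X_pow_eq (f : Lift K) (i : Fin 2) :
    ∃ (N : ℕ) (g : Fin 2 → MvPolynomial (Fin 2) K),
      (MvPolynomial.X i : MvPolynomial (Fin 2) K) ^ N = ∑ j, g j * f.form j := by
  have h1 : (MvPolynomial.X i : MvPolynomial (Fin 2) K) ∈
      (Ideal.span (Set.range f.form)).radical := by
    rw [← MvPolynomial.vanishingIdeal_zeroLocus_eq_radical (K := AlgebraicClosure K),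
      MvPolynomial.mem_vanishingIdeal_iff]
    intro x hx
    have h2 : x = 0 := f.eq_zero_of_forall x fun j =>
      MvPolynomial.mem_zeroLocus_iff.1 hx _ (Ideal.subset_span ⟨j, rfl⟩)
    simp [h2]
  obtain ⟨N, hN⟩ := h1
  obtain ⟨g, hg⟩ := Ideal.mem_span_range_iff_exists_fun.1 hN
  exact ⟨N, g, hg.symm⟩

theorem Lift.sum_evalAt_mul_eval {f : Lift K} {i : Fin 2} {N : ℕ}
    {g : Fin 2 → MvPolynomial (Fin 2) K}
    (h : (MvPolynomial.X i : MvPolynomial (Fin 2) K) ^ N = ∑ j, g j * f.form j)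
    (x : Fin 2 → v.Completion) :
    x i ^ N = ∑ j, evalAt v (g j) x * f.eval (toCompletion v) x j := by
  have h1 := congrArg (MvPolynomial.eval₂Hom (toCompletion v) x) h
  simpa [evalAt, Lift.eval] using h1

theorem Lift.exists_bound (f : Lift K) : ∃ B : ℝ, 0 < B ∧ ∀ x : Fin 2 → v.Completion, ‖x‖ = 1 →
    B⁻¹ ≤ ‖f.eval (toCompletion v) x‖ ∧ ‖f.eval (toCompletion v) x‖ ≤ B := by
  choose N g hg using f.exists_X_pow_eq
  let b : MvPolynomial (Fin 2) K → ℝ := fun q => ∑ d ∈ q.support, v (q.coeff d)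
  have hb : ∀ q, 0 ≤ b q := fun q => Finset.sum_nonneg fun d _ => v.nonneg _
  let B : ℝ := 1 + ∑ j, b (f.form j) + ∑ i, ∑ j, b (g i j)
  have h1 : 0 ≤ ∑ j, b (f.form j) := Finset.sum_nonneg fun j _ => hb _
  have h2 : 0 ≤ ∑ i, ∑ j, b (g i j) :=
    Finset.sum_nonneg fun i _ => Finset.sum_nonneg fun j _ => hb _
  have hB : 0 < B := by positivity
  refine ⟨B, hB, fun x hx => ⟨?_, ?_⟩⟩
  · obtain ⟨i, hi⟩ := exists_norm_apply_eq_norm x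
    rw [inv_le_iff_one_le_mul₀ hB]
    calc (1 : ℝ) = ‖x i ^ N i‖ := by rw [norm_pow, hi, hx, one_pow]
      _ = ‖∑ j, evalAt v (g i j) x * f.eval (toCompletion v) x j‖ := by
        rw [Lift.sum_evalAt_mul_eval v (hg i)]
      _ ≤ ∑ j, b (g i j) * ‖f.eval (toCompletion v) x‖ := by
        refine (norm_sum_le _ _).trans (Finset.sum_le_sum fun j _ => ?_)
        rw [norm_mul]
        exact mul_le_mul (norm_evalAt_le v _ hx.le) (norm_le_pi_norm _ j) (norm_nonneg _) (hb _)
      _ ≤ B * ‖f.eval (toCompletion v) x‖ := by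
        rw [← Finset.sum_mul]
        refine mul_le_mul_of_nonneg_right ?_ (norm_nonneg _)
        have h3 := Finset.single_le_sum (f := fun i => ∑ j, b (g i j))
          (fun i _ => Finset.sum_nonneg fun j _ => hb (g i j)) (Finset.mem_univ i)
        simp only [B]
        linarith
      _ = _ := by ring
  · refine (pi_norm_le_iff_of_nonneg hB.le).2 fun j => (norm_evalAt_le v (f.form j) hx.le).trans ?_
    have h3 := Finset.single_le_sum (f := fun j => b (f.form j))
      (fun j _ => hb (f.form j)) (Finset.mem_univ j)
    simp only [B]
    linarith

theorem exists_smul_eq {L : Type*} [NormedField L] {x : Fin 2 → L} (hx : x ≠ 0) :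
    ∃ (c : L) (y : Fin 2 → L), c ≠ 0 ∧ ‖y‖ = 1 ∧ x = c • y := by
  obtain ⟨i, hi⟩ := exists_norm_apply_eq_norm x
  have h0 : ‖x‖ ≠ 0 := norm_ne_zero_iff.2 hx
  have hc : x i ≠ 0 := norm_ne_zero_iff.1 (hi ▸ h0)
  refine ⟨x i, (x i)⁻¹ • x, hc, ?_, (smul_inv_smul₀ hc x).symm⟩
  rw [norm_smul, norm_inv, hi, inv_mul_cancel₀ h0]

theorem Lift.eval_toCompletion_ne_zero (f : Lift K) {x : Fin 2 → v.Completion} (hx : x ≠ 0) :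
    f.eval (toCompletion v) x ≠ 0 := by
  obtain ⟨B, hB, h⟩ := f.exists_bound v
  obtain ⟨c, y, hc, hy, rfl⟩ := exists_smul_eq hx
  rw [f.eval_smul]
  refine smul_ne_zero (pow_ne_zero _ hc) (norm_pos_iff.1 ?_)
  exact (inv_pos.2 hB).trans_le (h y hy).1

theorem Lift.exists_log_bound (f : Lift K) : ∃ C : ℝ, 0 ≤ C ∧ ∀ x : Fin 2 → v.Completion, x ≠ 0 →
    |Real.log ‖f.eval (toCompletion v) x‖ - f.degree * Real.log ‖x‖| ≤ C := by
  obtain ⟨B, hB, h⟩ := f.exists_bound v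
  refine ⟨|Real.log B|, abs_nonneg _, fun x hx => ?_⟩
  obtain ⟨c, y, hc, hy, rfl⟩ := exists_smul_eq hx
  have hy0 : y ≠ 0 := norm_ne_zero_iff.1 (by rw [hy]; exact one_ne_zero)
  have hF := norm_pos_iff.2 (f.eval_toCompletion_ne_zero v hy0)
  have hc' := norm_ne_zero_iff.2 hc
  rw [f.eval_smul, norm_smul, norm_smul, hy, mul_one, norm_pow,
    Real.log_mul (pow_ne_zero _ hc') hF.ne', Real.log_pow, add_sub_cancel_left]
  refine (abs_le.2 ⟨?_, Real.log_le_log hF (h y hy).2⟩).trans (le_abs_self _)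
  rw [← Real.log_inv]
  exact Real.log_le_log (inv_pos.2 hB) (h y hy).1

theorem Lift.norm_eval_eq_one (hv : ∀ n : ℕ, v n ≤ 1) {f : Lift K} {N : Fin 2 → ℕ}
    {g : Fin 2 → Fin 2 → MvPolynomial (Fin 2) K}
    (h : ∀ i, (MvPolynomial.X i : MvPolynomial (Fin 2) K) ^ N i = ∑ j, g i j * f.form j)
    (hf : ∀ j d, v ((f.form j).coeff d) ≤ 1) (hg : ∀ i j d, v ((g i j).coeff d) ≤ 1)
    {x : Fin 2 → v.Completion} (hx : ‖x‖ = 1) : ‖f.eval (toCompletion v) x‖ = 1 := by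
  have := isUltrametricDist_completion hv
  refine le_antisymm ((pi_norm_le_iff_of_nonneg zero_le_one).2 fun j =>
    norm_evalAt_le_one v hv (hf j) hx.le) ?_
  obtain ⟨i, hi⟩ := exists_norm_apply_eq_norm x
  calc (1 : ℝ) = ‖x i ^ N i‖ := by rw [norm_pow, hi, hx, one_pow]
    _ = ‖∑ j, evalAt v (g i j) x * f.eval (toCompletion v) x j‖ := by
      rw [Lift.sum_evalAt_mul_eval v (h i)]
    _ ≤ _ := by
      refine IsUltrametricDist.norm_sum_le_of_forall_le_of_nonneg (norm_nonneg _) fun j _ => ?_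
      rw [norm_mul]
      calc _ ≤ 1 * ‖f.eval (toCompletion v) x‖ :=
            mul_le_mul (norm_evalAt_le_one v hv (hg i j) hx.le) (norm_le_pi_norm _ j)
              (norm_nonneg _) zero_le_one
        _ = _ := one_mul _

end LocalBounds

section GoodReduction

variable {k : Type} [Field k] {M : Set (AbsoluteValue k ℝ)} (hM : IsGlobalBase k M)
  {K : Type*} [Field K] [Algebra k K] [FiniteDimensional k K] [Algebra.IsSeparable k K]

include hM

theorem finite_setOf_exists_one_lt_coeff (f : MvPolynomial (Fin 2) K) :
    {v : Place M K | ∃ d, 1 < v.1 (f.coeff d)}.Finite := by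
  refine ((Finset.finite_toSet f.support).biUnion fun d _ =>
    finite_setOf_one_lt hM (f.coeff d)).subset ?_
  rintro v ⟨d, hd⟩
  have h0 : f.coeff d ≠ 0 := by
    intro h
    rw [h, map_zero] at hd
    linarith
  exact Set.mem_biUnion (MvPolynomial.mem_support_iff.2 h0) hd

/-- A lift has good reduction at almost all places: there it preserves the vectors of norm one. -/
theorem Lift.finite_setOf_bad (f : Lift K) :
    {v : Place M K | ¬ ∀ x : Fin 2 → v.1.Completion, ‖x‖ = 1 →
      ‖f.eval (toCompletion v.1) x‖ = 1}.Finite := by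
  choose N g hg using f.exists_X_pow_eq
  refine ((finite_setOf_not_natCast_le_one (K := K) hM).union
    ((Set.finite_iUnion fun j => finite_setOf_exists_one_lt_coeff hM (f.form j)).union
      (Set.finite_iUnion fun i => Set.finite_iUnion fun j =>
        finite_setOf_exists_one_lt_coeff hM (g i j)))).subset ?_
  intro v hv
  by_contra hcon
  simp only [Set.mem_union, Set.mem_ofPred_eq, not_or, not_not, Set.mem_iUnion, not_exists,
    not_lt] at hcon
  exact hv fun x hx => Lift.norm_eval_eq_one v.1 hcon.1 hg hcon.2.1 hcon.2.2 hx

end GoodReduction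

section Green

variable {K : Type*} [Field K]

/-- `deg γ̃_n`, as a natural number. -/
def orbitDegree (γt : ℕ → Lift K) (n : ℕ) : ℕ := ∏ i ∈ Finset.range n, (γt i).degree

theorem liftOrbit_smul (γt : ℕ → Lift K) {L : Type*} [Field L] (σ : K →+* L) (c : L)
    (x : Fin 2 → L) (n : ℕ) :
    liftOrbit γt σ n (c • x) = c ^ orbitDegree γt n • liftOrbit γt σ n x := by
  induction n with
  | zero => simp [liftOrbit, orbitDegree]
  | succ n ih =>
    simp only [liftOrbit]
    rw [ih, Lift.eval_smul, ← pow_mul, orbitDegree, orbitDegree, Finset.prod_range_succ]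

theorem liftOrbit_comp (γt : ℕ → Lift K) {L : Type*} [Field L] (σ : K →+* L) (x : Fin 2 → K)
    (n : ℕ) : liftOrbit γt σ n (fun i => σ (x i)) =
      fun i => σ (liftOrbit γt (RingHom.id K) n x i) := by
  induction n with
  | zero => rfl
  | succ n ih =>
    simp only [liftOrbit]
    rw [ih]
    funext i
    simp only [Lift.eval]
    rw [MvPolynomial.hom_eval₂]
    rfl

variable {v : AbsoluteValue K ℝ} {γt : ℕ → Lift K}

theorem liftOrbit_ne_zero {x : Fin 2 → v.Completion} (hx : x ≠ 0) (n : ℕ) :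
    liftOrbit γt (toCompletion v) n x ≠ 0 := by
  induction n with
  | zero => exact hx
  | succ n ih => exact Lift.eval_toCompletion_ne_zero v _ ih

theorem continuous_liftOrbit (n : ℕ) : Continuous (liftOrbit γt (toCompletion v) n) := by
  induction n with
  | zero => exact continuous_id
  | succ n ih =>
    have h1 : Continuous fun x : Fin 2 → v.Completion => (γt n).eval (toCompletion v) x := by
      refine continuous_pi fun i => ?_
      simp only [Lift.eval, MvPolynomial.eval₂_eq']
      fun_prop
    exact h1.comp ih

variable (hfin : (Set.range γt).Finite) (hdeg : ∀ n, 2 ≤ (γt n).degree)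

include hdeg in
theorem two_pow_le_orbitDegree (n : ℕ) : (2 : ℝ) ^ n ≤ ∏ i ∈ Finset.range n, ((γt i).degree : ℝ) := by
  have h1 := Finset.prod_le_prod (s := Finset.range n) (f := fun _ => (2 : ℝ))
    (g := fun i => ((γt i).degree : ℝ)) (fun _ _ => by norm_num)
    (fun i _ => by exact_mod_cast hdeg i)
  simpa using h1

include hfin hdeg in
/-- The telescoping argument: consecutive terms of the sequence defining the Green function differ
by at most `C / 2 ^ (n + 1)`, uniformly on `K_v² ∖ {0}`. -/
theorem exists_green_bound (v : AbsoluteValue K ℝ) : ∃ C : ℝ,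
    ∀ x : Fin 2 → v.Completion, x ≠ 0 →
      Tendsto (greenSeq v γt x) atTop (𝓝 (green v γt x)) ∧
      ∀ n, |greenSeq v γt x n - green v γt x| ≤ C / 2 ^ n := by
  choose c hc0 hc using fun f : Lift K => f.exists_log_bound v
  obtain ⟨C, hC⟩ := (hfin.image c).bddAbove
  have hC : ∀ n, c (γt n) ≤ C := fun n => hC ⟨_, ⟨n, rfl⟩, rfl⟩
  have hstep : ∀ x : Fin 2 → v.Completion, x ≠ 0 → ∀ n,
      dist (greenSeq v γt x n) (greenSeq v γt x (n + 1)) ≤ C / 2 / 2 ^ n := by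
    intro x hx n
    have h1 := hc (γt n) _ (liftOrbit_ne_zero (γt := γt) hx n)
    have hD := two_pow_le_orbitDegree hdeg n
    have hd : (2 : ℝ) ≤ (γt n).degree := by exact_mod_cast hdeg n
    have h2 : (0 : ℝ) < 2 ^ n := by positivity
    have hDpos := h2.trans_le hD
    have hdpos : (0 : ℝ) < (γt n).degree := by linarith
    have heq : greenSeq v γt x (n + 1) - greenSeq v γt x n =
        (Real.log ‖(γt n).eval (toCompletion v) (liftOrbit γt (toCompletion v) n x)‖ -
          (γt n).degree * Real.log ‖liftOrbit γt (toCompletion v) n x‖) /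
        ((∏ i ∈ Finset.range n, ((γt i).degree : ℝ)) * (γt n).degree) := by
      simp only [greenSeq, liftOrbit, Finset.prod_range_succ]
      field_simp
    rw [dist_comm, Real.dist_eq, heq, abs_div, abs_of_pos (mul_pos hDpos hdpos), div_div,
      mul_comm (2 : ℝ)]
    exact div_le_div₀ ((hc0 _).trans (hC n)) (h1.trans (hC n)) (by positivity)
      (mul_le_mul hD hd (by norm_num) hDpos.le)
  refine ⟨C, fun x hx => ?_⟩
  have hlim : Tendsto (greenSeq v γt x) atTop (𝓝 (green v γt x)) :=
    (cauchySeq_of_le_geometric_two (hstep x hx)).tendsto_limUnder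
  exact ⟨hlim, fun n => dist_le_of_le_geometric_two_of_tendsto (hstep x hx) hlim n⟩

include hfin hdeg in
theorem green_smul {c : v.Completion} (hc : c ≠ 0) {x : Fin 2 → v.Completion} (hx : x ≠ 0) :
    green v γt (c • x) = Real.log ‖c‖ + green v γt x := by
  obtain ⟨C, hC⟩ := exists_green_bound hfin hdeg v
  refine tendsto_nhds_unique (hC _ (smul_ne_zero hc hx)).1 ?_
  have h1 : greenSeq v γt (c • x) = fun n => Real.log ‖c‖ + greenSeq v γt x n := by
    funext n
    have hD : (0 : ℝ) < ∏ i ∈ Finset.range n, ((γt i).degree : ℝ) :=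
      lt_of_lt_of_le (by positivity) (two_pow_le_orbitDegree hdeg n)
    rw [greenSeq, liftOrbit_smul, norm_smul, norm_pow,
      Real.log_mul (pow_ne_zero _ (norm_ne_zero_iff.2 hc))
        (norm_ne_zero_iff.2 (liftOrbit_ne_zero hx n)), Real.log_pow, greenSeq, orbitDegree]
    push_cast
    field_simp
  rw [h1]
  exact (hC x hx).1.const_add _

include hfin hdeg in
theorem continuous_green :
    Continuous fun x : {x : Fin 2 → v.Completion // x ≠ 0} => green v γt x.1 := by
  obtain ⟨C, hC⟩ := exists_green_bound hfin hdeg v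
  have h1 : TendstoUniformly (fun n (x : {x : Fin 2 → v.Completion // x ≠ 0}) =>
      greenSeq v γt x.1 n) (fun x => green v γt x.1) atTop := by
    rw [Metric.tendstoUniformly_iff]
    intro ε hε
    have h2 : Tendsto (fun n : ℕ => C / 2 ^ n) atTop (𝓝 0) :=
      tendsto_const_nhds.div_atTop (tendsto_pow_atTop_atTop_of_one_lt one_lt_two)
    filter_upwards [h2.eventually_lt_const hε] with n hn x
    rw [dist_comm]
    exact ((hC x.1 x.2).2 n).trans_lt hn
  refine h1.continuous (Frequently.of_forall fun n => ?_)
  refine Continuous.div_const (Continuous.log ?_ fun x => ?_) _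
  · exact ((continuous_liftOrbit n).comp continuous_subtype_val).norm
  · exact norm_ne_zero_iff.2 (liftOrbit_ne_zero x.2 n)

include hfin hdeg in
/-- The difference of the Green function and the logarithm of the norm is a bounded continuous
function on the projective line. -/
theorem exists_boundedContinuousFunction_green (v : AbsoluteValue K ℝ) :
    ∃ F : BoundedContinuousFunction (P1 v.Completion) ℝ,
      ∀ (x : Fin 2 → v.Completion) (hx : x ≠ 0),
        F (Projectivization.mk _ x hx) = green v γt x - Real.log ‖x‖ := by
  obtain ⟨C, hC⟩ := exists_green_bound hfin hdeg v
  let φ : P1 v.Completion → ℝ := Projectivization.lift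
    (fun x : {x : Fin 2 → v.Completion // x ≠ 0} => green v γt x.1 - Real.log ‖x.1‖) (by
      rintro ⟨a, ha⟩ ⟨b, hb⟩ t h
      simp only at h
      subst h
      have ht : t ≠ 0 := by
        rintro rfl
        simp at ha
      simp only
      rw [green_smul hfin hdeg ht hb, norm_smul,
        Real.log_mul (norm_ne_zero_iff.2 ht) (norm_ne_zero_iff.2 hb)]
      ring)
  have hφ : Continuous φ := by
    refine continuous_coinduced_dom.2 ?_
    exact (continuous_green hfin hdeg).sub
      (Continuous.log continuous_subtype_val.norm fun x => norm_ne_zero_iff.2 x.2)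
  refine ⟨BoundedContinuousFunction.ofNormedAddCommGroup φ hφ C fun P => ?_, fun x hx => rfl⟩
  induction P using Projectivization.ind with
  | h x hx =>
    have h1 := (hC x hx).2 0
    rw [abs_sub_comm] at h1
    change |green v γt x - Real.log ‖x‖| ≤ C
    simpa [greenSeq, liftOrbit] using h1

end Green

/-! ### Local canonical heights and the height decomposition -/

section Decomposition

theorem orbit_ofLift {K : Type*} [Field K] (γt : ℕ → Lift K) (P : P1 K) {x : Fin 2 → K}
    (hx : x ≠ 0) (hP : P = Projectivization.mk K x hx) (n : ℕ) :
    ∃ h : liftOrbit γt (RingHom.id K) n x ≠ 0,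
      orbit (fun n => Endo.ofLift (γt n)) n P = Projectivization.mk K _ h := by
  induction n with
  | zero => exact ⟨hx, hP⟩
  | succ n ih =>
    obtain ⟨h, ih⟩ := ih
    refine ⟨(γt n).eval_ne_zero h, ?_⟩
    rw [orbit, ih]
    rfl

theorem P1.map_mk {K L : Type*} [Field K] [Field L] (σ : K →+* L) {x : Fin 2 → K} (hx : x ≠ 0)
    (h : (fun i => σ (x i)) ≠ 0) :
    P1.map σ (Projectivization.mk K x hx) = Projectivization.mk L (fun i => σ (x i)) h := rfl

theorem evalAt_smul {K : Type*} [Field K] (v : AbsoluteValue K ℝ) {E : MvPolynomial (Fin 2) K}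
    {e : ℕ} (hE : E.IsHomogeneous e) (c : v.Completion) (x : Fin 2 → v.Completion) :
    evalAt v E (c • x) = c ^ e * evalAt v E x := by
  simp only [evalAt, MvPolynomial.eval₂_eq', Finset.mul_sum]
  refine Finset.sum_congr rfl fun d hd => ?_
  have h1 : ∑ j, d j = e := by
    have h2 := hE (MvPolynomial.mem_support_iff.1 hd)
    rw [← h2, Finsupp.weight_apply, Finsupp.sum_fintype _ _ (by simp)]
    simp
  simp only [Pi.smul_apply, smul_eq_mul, mul_pow, Finset.prod_mul_distrib,
    Finset.prod_pow_eq_pow_sum, h1]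
  ring

/-- The local canonical height does not depend on the homogeneous coordinates. -/
theorem localHeight_mk {K : Type*} [Field K] {v : AbsoluteValue K ℝ} {γt : ℕ → Lift K}
    (hfin : (Set.range γt).Finite) (hdeg : ∀ n, 2 ≤ (γt n).degree) {E : MvPolynomial (Fin 2) K}
    {e : ℕ} (hE : E.IsHomogeneous e) {x : Fin 2 → v.Completion} (hx : x ≠ 0)
    (hEx : evalAt v E x ≠ 0) :
    localHeight v γt E e (Projectivization.mk _ x hx) =
      e * green v γt x - Real.log ‖evalAt v E x‖ := by
  obtain ⟨a, ha⟩ := Projectivization.exists_smul_eq_mk_rep v.Completion x hx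
  have ha0 : (a : v.Completion) ≠ 0 := a.ne_zero
  have ha' : (Projectivization.mk v.Completion x hx).rep = (a : v.Completion) • x := ha.symm
  rw [localHeight, ha', green_smul hfin hdeg ha0 hx, evalAt_smul v hE, norm_mul, norm_pow,
    Real.log_mul (pow_ne_zero _ (norm_ne_zero_iff.2 ha0)) (norm_ne_zero_iff.2 hEx), Real.log_pow]
  ring

variable {k : Type} [Field k] {M : Set (AbsoluteValue k ℝ)} (hM : IsGlobalBase k M)
  {K : Type*} [Field K] [Algebra k K] [FiniteDimensional k K] [Algebra.IsSeparable k K]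

include hM

theorem finite_setOf_norm_ne_one {x : Fin 2 → K} (hx : x ≠ 0) :
    {v : Place M K | ‖fun i => toCompletion v.1 (x i)‖ ≠ 1}.Finite := by
  have h1 : ∀ i, {v : Place M K | x i ≠ 0 ∧ v.1 (x i) ≠ 1}.Finite := fun i => by
    by_cases hi : x i = 0
    · simp [hi]
    · simpa [hi] using finite_setOf_ne_one hM hi
  refine (Set.finite_iUnion h1).subset fun v hv => ?_
  by_contra hcon
  simp only [Set.mem_iUnion, Set.mem_ofPred_eq, not_exists, not_and, not_not] at hcon
  have hle : ∀ i, ‖toCompletion v.1 (x i)‖ ≤ 1 := fun i => by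
    by_cases hi : x i = 0
    · simp [hi]
    · rw [norm_toCompletion, hcon i hi]
  refine hv (le_antisymm ((pi_norm_le_iff_of_nonneg zero_le_one).2 hle) ?_)
  obtain ⟨i, hi⟩ := Function.ne_iff.1 hx
  have h2 := norm_le_pi_norm (fun i => toCompletion v.1 (x i)) i
  rwa [norm_toCompletion, hcon i hi] at h2

theorem weilHeight_mk {x : Fin 2 → K} (hx : x ≠ 0) :
    weilHeight M (Projectivization.mk K x hx) =
      ∑ᶠ v : Place M K, weight k v.1 * Real.log ‖fun i => toCompletion v.1 (x i)‖ := by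
  obtain ⟨a, ha⟩ := Projectivization.exists_smul_eq_mk_rep K x hx
  have ha0 : (a : K) ≠ 0 := a.ne_zero
  have ha' : (Projectivization.mk K x hx).rep = (a : K) • x := ha.symm
  have hpos : ∀ v : Place M K, ‖fun i => toCompletion v.1 (x i)‖ ≠ 0 := fun v => by
    rw [norm_ne_zero_iff]
    intro h
    exact hx (funext fun i => (toCompletion v.1).injective ((congrFun h i).trans (map_zero _).symm))
  have h1 : ∀ v : Place M K, weight k v.1 *
      Real.log (max (v.1 ((Projectivization.mk K x hx).rep 0))
        (v.1 ((Projectivization.mk K x hx).rep 1))) =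
      weight k v.1 * Real.log (v.1 a) +
        weight k v.1 * Real.log ‖fun i => toCompletion v.1 (x i)‖ := fun v => by
    rw [ha', Pi.smul_apply, Pi.smul_apply, smul_eq_mul, smul_eq_mul, map_mul, map_mul,
      ← mul_max_of_nonneg _ _ (v.1.nonneg _), ← norm_toCompletion_comp, ← mul_add,
      Real.log_mul (v.1.ne_zero ha0) (hpos v)]
  rw [weilHeight]
  simp only [h1]
  rw [finsum_add_distrib, finsum_weight_mul_log hM ha0, zero_add]
  · refine (finite_setOf_ne_one hM ha0).subset fun v hv h => hv ?_
    simp [h]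
  · refine (finite_setOf_norm_ne_one hM hx).subset fun v hv h => hv ?_
    simp [h]

/-- At almost all places a point of `ℙ¹(K)` has coordinates of norm one, all the lifts have good
reduction, and the whole orbit consists of vectors of norm one. -/
theorem finite_setOf_liftOrbit_norm_ne_one {γt : ℕ → Lift K} (hfin : (Set.range γt).Finite)
    {x : Fin 2 → K} (hx : x ≠ 0) :
    {v : Place M K | ¬ ∀ n,
      ‖liftOrbit γt (toCompletion v.1) n (fun i => toCompletion v.1 (x i))‖ = 1}.Finite := by
  refine ((finite_setOf_norm_ne_one hM hx).union
    (hfin.biUnion fun f _ => f.finite_setOf_bad hM)).subset fun v hv => ?_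
  by_contra hcon
  simp only [Set.mem_union, Set.mem_ofPred_eq, not_or, not_not, Set.mem_iUnion, not_exists,
    Set.mem_range, forall_exists_index, forall_apply_eq_imp_iff] at hcon
  refine hv fun n => ?_
  induction n with
  | zero => exact hcon.1
  | succ n ih => exact hcon.2 n _ ih

/-- All terms with index outside a finite set of places independent of `n` vanish, so the limit can
be taken term by term; the terms `log |E(x)|_v` cancel by the product formula. -/
theorem finite_support_and_tendsto_heightSeq {γt : ℕ → Lift K} (hfin : (Set.range γt).Finite)
    (hdeg : ∀ n, 2 ≤ (γt n).degree) {E : MvPolynomial (Fin 2) K} {e : ℕ} (hE : E.IsHomogeneous e)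
    (he : 0 < e) {P : P1 K} (hEP : MvPolynomial.eval P.rep E ≠ 0) :
    (Function.support fun v : Place M K => weight k v.1 *
        localHeight v.1 γt E e (P1.map (toCompletion v.1) P)).Finite ∧
    Tendsto (heightSeq M (fun n => Endo.ofLift (γt n)) P) atTop
      (𝓝 (1 / (e : ℝ) * ∑ᶠ v : Place M K, weight k v.1 *
        localHeight v.1 γt E e (P1.map (toCompletion v.1) P))) := by
  obtain ⟨x, hx', hxP⟩ : ∃ x, x = P.rep ∧ x ≠ 0 := ⟨_, rfl, P.rep_nonzero⟩
  rw [← hx'] at hEP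
  have hP : P = Projectivization.mk K x hxP := by
    subst hx'
    exact P.mk_rep.symm
  let y : ∀ v : Place M K, Fin 2 → v.1.Completion := fun v i => toCompletion v.1 (x i)
  have hy : ∀ v, y v ≠ 0 := fun v h =>
    hxP (funext fun i => (toCompletion v.1).injective ((congrFun h i).trans (map_zero _).symm))
  have hEy : ∀ v : Place M K, evalAt v.1 E (y v) = toCompletion v.1 (MvPolynomial.eval x E) := by
    intro v
    rw [MvPolynomial.eval, MvPolynomial.coe_eval₂Hom, MvPolynomial.hom_eval₂]
    rfl
  have hEy0 : ∀ v : Place M K, evalAt v.1 E (y v) ≠ 0 := fun v => by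
    rw [hEy]
    exact (map_ne_zero _).2 hEP
  have hloc : ∀ v : Place M K, localHeight v.1 γt E e (P1.map (toCompletion v.1) P) =
      e * green v.1 γt (y v) - Real.log (v.1 (MvPolynomial.eval x E)) := by
    intro v
    rw [hP, P1.map_mk _ hxP (hy v), localHeight_mk hfin hdeg hE (hy v) (hEy0 v), hEy,
      norm_toCompletion]
  let B : Set (Place M K) := {v | ¬ ∀ n, ‖liftOrbit γt (toCompletion v.1) n (y v)‖ = 1}
  have hB : B.Finite := finite_setOf_liftOrbit_norm_ne_one hM hfin hxP
  have hlim : ∀ v : Place M K,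
      Tendsto (greenSeq v.1 γt (y v)) atTop (𝓝 (green v.1 γt (y v))) := fun v => by
    obtain ⟨C, hC⟩ := exists_green_bound hfin hdeg v.1
    exact (hC _ (hy v)).1
  have hseq0 : ∀ v, v ∉ B → ∀ n, greenSeq v.1 γt (y v) n = 0 := fun v hv n => by
    rw [greenSeq, not_not.1 hv n, Real.log_one, zero_div]
  have hgreen0 : ∀ v, v ∉ B → green v.1 γt (y v) = 0 := fun v hv => by
    refine tendsto_nhds_unique (hlim v) ?_
    rw [funext (hseq0 v hv)]
    exact tendsto_const_nhds
  have hEfin := finite_setOf_ne_one hM hEP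
  have hs1 : (Function.support fun v : Place M K =>
      (e : ℝ) * (weight k v.1 * green v.1 γt (y v))).Finite := by
    refine hB.subset fun v hv => ?_
    by_contra h
    exact hv (by simp [hgreen0 v h])
  have hs2 : (Function.support fun v : Place M K =>
      weight k v.1 * Real.log (v.1 (MvPolynomial.eval x E))).Finite := by
    refine hEfin.subset fun v hv h => hv ?_
    simp [h]
  have hterm : ∀ v : Place M K, weight k v.1 *
      localHeight v.1 γt E e (P1.map (toCompletion v.1) P) =
      (e : ℝ) * (weight k v.1 * green v.1 γt (y v)) -
        weight k v.1 * Real.log (v.1 (MvPolynomial.eval x E)) := fun v => by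
    rw [hloc]
    ring
  simp only [hterm]
  refine ⟨(hs1.union hs2).subset (Function.support_sub _ _), ?_⟩
  have he' : (e : ℝ) ≠ 0 := by exact_mod_cast he.ne'
  rw [finsum_sub_distrib hs1 hs2, finsum_weight_mul_log hM hEP, sub_zero, ← mul_finsum, ← mul_assoc,
    one_div, inv_mul_cancel₀ he', one_mul,
    finsum_eq_sum_of_support_subset (s := hB.toFinset) _ (by
      intro v hv
      rw [Set.Finite.coe_toFinset]
      by_contra h
      exact hv (by simp [hgreen0 v h]))]
  have hh : heightSeq M (fun n => Endo.ofLift (γt n)) P = fun n =>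
      ∑ v ∈ hB.toFinset, weight k v.1 * greenSeq v.1 γt (y v) n := by
    funext n
    obtain ⟨h, hn⟩ := orbit_ofLift γt P hxP hP n
    have hnorm : ∀ v : Place M K,
        (fun i => toCompletion v.1 (liftOrbit γt (RingHom.id K) n x i)) =
          liftOrbit γt (toCompletion v.1) n (y v) := fun v =>
      (liftOrbit_comp γt (toCompletion v.1) x n).symm
    rw [heightSeq, hn, weilHeight_mk hM h, finsum_eq_sum_of_support_subset (s := hB.toFinset) _ (by
      intro v hv
      rw [Set.Finite.coe_toFinset]
      by_contra h'
      exact hv (by simp only [hnorm, not_not.1 h' n, Real.log_one, mul_zero])), Finset.sum_div]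
    refine Finset.sum_congr rfl fun v _ => ?_
    rw [hnorm, mul_div_assoc]
    rfl
  rw [hh]
  exact tendsto_finsetSum _ fun v _ => (hlim v).const_mul _

end Decomposition

end LocalHeights

open LocalHeights in
theorem theorem4p2
    (K₀ : Type) [Field K₀] (M₀ : Set (AbsoluteValue K₀ ℝ)) (hM₀ : IsGlobalBase K₀ M₀)
    (K : Type*) [Field K] [Algebra K₀ K] [FiniteDimensional K₀ K] [Algebra.IsSeparable K₀ K]
    (S : Set (Endo K)) (hS : S.Finite) (hdeg : ∀ φ ∈ S, 2 ≤ φ.degree)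
    (lift : S → Lift K) (hlift : ∀ φ : S, Endo.ofLift (lift φ) = φ)
    (γ : ℕ → S) (E : MvPolynomial (Fin 2) K) (e : ℕ) (hE : E.IsHomogeneous e) :
    -- the Green functions exist
    (∀ (v : Place M₀ K) (x : Fin 2 → v.1.Completion), x ≠ 0 →
      Tendsto (greenSeq v.1 (fun n => lift (γ n)) x) atTop
        (𝓝 (green v.1 (fun n => lift (γ n)) x))) ∧
    -- (1) the local canonical height is well defined where `E ≠ 0`
    (∀ (v : Place M₀ K) (x : Fin 2 → v.1.Completion) (hx : x ≠ 0), evalAt v.1 E x ≠ 0 →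
      localHeight v.1 (fun n => lift (γ n)) E e (Projectivization.mk _ x hx) =
        e * green v.1 (fun n => lift (γ n)) x - Real.log ‖evalAt v.1 E x‖) ∧
    -- (2) its sum with `log (|E|_v / ‖·‖_v ^ e)` extends to a bounded continuous function
    (∀ v : Place M₀ K, ∃ F : BoundedContinuousFunction (P1 v.1.Completion) ℝ,
      ∀ (x : Fin 2 → v.1.Completion) (hx : x ≠ 0), evalAt v.1 E x ≠ 0 →
        F (Projectivization.mk _ x hx) =
          localHeight v.1 (fun n => lift (γ n)) E e (Projectivization.mk _ x hx) +
            Real.log (‖evalAt v.1 E x‖ / ‖x‖ ^ e)) ∧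
    -- (3) the decomposition of the canonical height
    (0 < e → ∀ P : P1 K, MvPolynomial.eval P.rep E ≠ 0 →
      Tendsto (heightSeq M₀ (fun n => (γ n : Endo K)) P) atTop
        (𝓝 (canonicalHeight M₀ (fun n => (γ n : Endo K)) P)) ∧
      (Function.support fun v : Place M₀ K => weight K₀ v.1 *
        localHeight v.1 (fun n => lift (γ n)) E e (P1.map (toCompletion v.1) P)).Finite ∧
      canonicalHeight M₀ (fun n => (γ n : Endo K)) P =
        1 / (e : ℝ) * ∑ᶠ v : Place M₀ K, weight K₀ v.1 *
          localHeight v.1 (fun n => lift (γ n)) E e (P1.map (toCompletion v.1) P)) := by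

  have hfin : (Set.range fun n => lift (γ n)).Finite := by
    have : Finite S := hS
    exact (Set.finite_range lift).subset (Set.range_comp_subset_range γ lift)
  have hdeg' : ∀ n, 2 ≤ (lift (γ n)).degree := fun n => by
    have h1 := hdeg _ (γ n).2
    rw [← hlift (γ n)] at h1
    exact h1
  have hγ : (fun n => (γ n : Endo K)) = fun n => Endo.ofLift (lift (γ n)) :=
    funext fun n => (hlift (γ n)).symm
  refine ⟨fun v x hx => ?_, fun v x hx hEx => localHeight_mk hfin hdeg' hE hx hEx, fun v => ?_,
    fun he P hEP => ?_⟩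
  · obtain ⟨C, hC⟩ := exists_green_bound hfin hdeg' v.1
    exact (hC x hx).1
  · obtain ⟨F, hF⟩ := exists_boundedContinuousFunction_green hfin hdeg' v.1
    refine ⟨(e : ℝ) • F, fun x hx hEx => ?_⟩
    change (e : ℝ) * F _ = _
    rw [localHeight_mk hfin hdeg' hE hx hEx, hF x hx,
      Real.log_div (norm_ne_zero_iff.2 hEx) (pow_ne_zero _ (norm_ne_zero_iff.2 hx)), Real.log_pow]
    ring
  · obtain ⟨h1, h2⟩ := finite_support_and_tendsto_heightSeq hM₀ hfin hdeg' hE he hEP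
    rw [← hγ] at h2
    have h3 : canonicalHeight M₀ (fun n => (γ n : Endo K)) P = _ := h2.limUnder_eq
    rw [h3]
    exact ⟨h2, h1, rfl⟩
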